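/- Let $J\in\{\tfrac12,1,\tfrac32,\dots\}$ and let $|\Phi_{J}\rangle=(2J+1)^{-1/2}\sum_{m=-J}^{J}|J,m\rangle\otimes|J,m\rangle$ be the standard Bell state of two spin-$J$ particles. For a rotation $g\in \mathrm{SO}(3)$ let $U_{g,J}$ be the unitary matrix (defined up to a phase) that represents $g$ on a spin-$J$ particle, and let $|\Phi_{g,J}\rangle=(U_{g,J}\otimes I)|\Phi_J\rangle$ be the rotated Bell state. A Cartesian refbit is the state $|\Phi_{g,1/2}\rangle$. Let $\mathrm dg$ be the normalized Haar measure of $\mathrm{SO}(3)$. A deterministic machine is a completely positive trace-preserving map $\mathcal C$ from the operators on two spin-$J$ particles to the operators on $M$ pairs of spin-$1/2$ particles; its fidelity is $$F^{\rm det}(\mathcal C)=\int \mathrm dg\;\langle\Phi_{g,1/2}|^{\otimes M}\,\mathcal C\big(|\Phi_{g,J}\rangle\langle\Phi_{g,J}|\big)\,|\Phi_{g,1/2}\rangle^{\otimes M}.$$ A probabilistic machine is a completely positive trace-non-increasing map $\mathcal M$ between the same spaces, with success probability $p_{\rm succ}=\int \mathrm dg\,\mathrm{Tr}\big[\mathcal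 M(|\Phi_{g,J}\rangle\langle\Phi_{g,J}|)\big]>0$; its fidelity is $$F^{\rm prob}(\mathcal M)=\frac{1}{p_{\rm succ}}\int \mathrm dg\;\langle\Phi_{g,1/2}|^{\otimes M}\,\mathcal M\big(|\Phi_{g,J}\rangle\langle\Phi_{g,J}|\big)\,|\Phi_{g,1/2}\rangle^{\otimes M}.$$ **Proposition.** For every $J\in\{\tfrac12,1,\tfrac32,\dots\}$ and every $M\ge1$, every deterministic or probabilistic machine that converts a single spin-$J$ Bell state $|\Phi_{g,J}\rangle$ into $M$ Cartesian refbits $|\Phi_{g,1/2}\rangle^{\otimes M}$ has fidelity at most $$\frac12\left[1+\frac1{2J}\right].$$ In particular, for $J>1/2$ a single Bell state is unbreakable: the fidelity of every such machine, for every $M\ge 1$, is at most $3/4$, hence bounded away from $1$. -/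

import Mathlib

open scoped ComplexOrder
open Matrix MeasureTheory

noncomputable section

namespace SpinBell

/-! ### Spin operators

The Hilbert space of a particle of spin `J = n / 2` is `ℂ ^ (n + 1)`, with the orthonormal basis
`|J, J⟩, |J, J - 1⟩, …, |J, -J⟩`, indexed in this order by `Fin (n + 1)`. -/

/-- The spin quantum number `J = n / 2`. -/
def spin (n : ℕ) : ℝ := (n : ℝ) / 2

/-- The magnetic quantum number `m = J - i` of the basis vector with index `i`. -/
def mag (n : ℕ) (i : Fin (n + 1)) : ℝ := spin n - (i : ℕ)

/-- The raising operator, `J₊ |J, m⟩ = √(J (J + 1) - m (m + 1)) |J, m + 1⟩`. -/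
def spinPlus (n : ℕ) : Matrix (Fin (n + 1)) (Fin (n + 1)) ℂ :=
  Matrix.of fun i j =>
    if (j : ℕ) = (i : ℕ) + 1 then
      ((√(spin n * (spin n + 1) - mag n j * (mag n j + 1)) : ℝ) : ℂ)
    else 0

/-- The three components `J_x, J_y, J_z` of the angular momentum operator (with `ℏ = 1`). -/
def spinOp (n : ℕ) : Fin 3 → Matrix (Fin (n + 1)) (Fin (n + 1)) ℂ :=
  ![(1 / 2 : ℂ) • (spinPlus n + (spinPlus n)ᴴ),
    (-Complex.I / 2) • (spinPlus n - (spinPlus n)ᴴ),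
    Matrix.diagonal fun i => (mag n i : ℂ)]

/-! ### Rotations -/

/-- The rotation group `SO(3)`. -/
abbrev SO3 := Matrix.specialOrthogonalGroup (Fin 3) ℝ

/-- `U` represents the rotation `R` on a spin-`n / 2` particle: it is unitary, and it rotates the
angular momentum vector, `U J_k U† = ∑ l, R l k • J_l`. These conditions determine `U` up to a
phase factor. -/
def Represents (n : ℕ) (R : Matrix (Fin 3) (Fin 3) ℝ)
    (U : Matrix (Fin (n + 1)) (Fin (n + 1)) ℂ) : Prop :=
  U ∈ Matrix.unitaryGroup (Fin (n + 1)) ℂ ∧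
    ∀ k, U * spinOp n k * Uᴴ = ∑ l, (R l k : ℂ) • spinOp n l

/-! The remaining facts of this section show that every rotation is represented. -/

theorem comm_zp (n : ℕ) : spinOp n 2 * spinPlus n - spinPlus n * spinOp n 2 = spinPlus n := by
  ext i j
  simp only [spinOp, spinPlus, Matrix.sub_apply, Matrix.cons_val, Matrix.diagonal_mul,
    Matrix.mul_diagonal, Matrix.of_apply]
  split_ifs with h
  · have : mag n i = mag n j + 1 := by simp [mag, h]; ring
    rw [this]; push_cast; ring
  · simp

theorem comm_pm (n : ℕ) :
    spinPlus n * (spinPlus n)ᴴ - (spinPlus n)ᴴ * spinPlus n = (2 : ℂ) • spinOp n 2 := by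
  have e1 : spinPlus n * (spinPlus n)ᴴ =
      Matrix.diagonal fun i : Fin (n + 1) => (((i : ℕ) + 1 : ℂ) * (n - (i : ℕ))) := by
    ext i j
    simp only [spinPlus, Matrix.mul_apply, Matrix.conjTranspose_apply, Matrix.of_apply]
    rw [Matrix.diagonal_apply]
    by_cases hi : (i : ℕ) + 1 < n + 1
    · rw [Finset.sum_eq_single (⟨(i : ℕ) + 1, hi⟩ : Fin (n + 1))]
      · by_cases hij : i = j
        · subst hij
          simp only [if_true, Complex.star_def, Complex.conj_ofReal]
          rw [← Complex.ofReal_mul, Real.mul_self_sqrt]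
          · simp [mag, spin]; ring
          · have : (i : ℕ) + 1 ≤ n := by omega
            have h2 : ((i : ℕ) : ℝ) + 1 ≤ n := by exact_mod_cast this
            simp only [mag, spin]; push_cast
            nlinarith [(Nat.cast_nonneg (i : ℕ) : (0 : ℝ) ≤ _)]
        · have : ¬ ((i : ℕ) + 1 = (j : ℕ) + 1) := fun h => hij (Fin.ext (by omega))
          simp [hij, Fin.val_inj]
      · intro b _ hb
        have : ¬ ((b : ℕ) = (i : ℕ) + 1) := fun h => hb (Fin.ext h)
        simp [this]
      · simp
    · have hin : (i : ℕ) = n := by omega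
      rw [Finset.sum_eq_zero]
      · simp [hin]
      · intro b _
        have : ¬ ((b : ℕ) = (i : ℕ) + 1) := by omega
        simp [this]
  have e2 : (spinPlus n)ᴴ * spinPlus n =
      Matrix.diagonal fun i : Fin (n + 1) => (((i : ℕ) : ℂ) * (n - (i : ℕ) + 1)) := by
    ext i j
    simp only [spinPlus, Matrix.mul_apply, Matrix.conjTranspose_apply, Matrix.of_apply]
    rw [Matrix.diagonal_apply]
    by_cases hi : 0 < (i : ℕ)
    · have hlt : (i : ℕ) - 1 < n + 1 := by omega
      rw [Finset.sum_eq_single (⟨(i : ℕ) - 1, hlt⟩ : Fin (n + 1))]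
      · have h1 : (i : ℕ) - 1 + 1 = i := by omega
        by_cases hij : i = j
        · subst hij
          simp only [h1, if_true, Complex.star_def, Complex.conj_ofReal]
          rw [← Complex.ofReal_mul, Real.mul_self_sqrt]
          · simp [mag, spin]; ring
          · have : (i : ℕ) ≤ n := by omega
            have h2 : ((i : ℕ) : ℝ) ≤ n := by exact_mod_cast this
            have h3 : (1 : ℝ) ≤ (i : ℕ) := by exact_mod_cast hi
            simp only [mag, spin]
            nlinarith
        · have : ¬ ((j : ℕ) = (i : ℕ)) := fun h => hij (Fin.ext (by omega))
          simp [h1, hij, this]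
      · intro b _ hb
        have : ¬ ((i : ℕ) = (b : ℕ) + 1) := fun h => hb (Fin.ext (by simp; omega))
        simp [this]
      · simp
    · have hin : (i : ℕ) = 0 := by omega
      rw [Finset.sum_eq_zero]
      · simp [hin]
      · intro b _
        have : ¬ ((i : ℕ) = (b : ℕ) + 1) := by omega
        simp [this]
  rw [e1, e2, Matrix.diagonal_sub]
  simp only [spinOp, Matrix.cons_val]
  rw [← Matrix.diagonal_smul]
  congr 1
  ext i
  simp [mag, spin]; ring

theorem spinOp_two_herm (n : ℕ) : (spinOp n 2)ᴴ = spinOp n 2 := by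
  simp [spinOp, Matrix.diagonal_conjTranspose, Pi.star_def]

theorem spinOp_one_herm (n : ℕ) : (spinOp n 1)ᴴ = spinOp n 1 := by
  simp [spinOp, Matrix.conjTranspose_smul, neg_div]
  rw [← smul_neg]; simp

theorem comm_zm (n : ℕ) :
    spinOp n 2 * (spinPlus n)ᴴ - (spinPlus n)ᴴ * spinOp n 2 = -(spinPlus n)ᴴ := by
  have h := congrArg Matrix.conjTranspose (comm_zp n)
  rw [Matrix.conjTranspose_sub, Matrix.conjTranspose_mul, Matrix.conjTranspose_mul,
    spinOp_two_herm] at h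
  rw [← neg_sub, h]

theorem comm_zx (n : ℕ) :
    spinOp n 2 * spinOp n 0 - spinOp n 0 * spinOp n 2 = Complex.I • spinOp n 1 := by
  have h1 := comm_zp n
  have h2 := comm_zm n
  have e0 : spinOp n 0 = (1 / 2 : ℂ) • (spinPlus n + (spinPlus n)ᴴ) := rfl
  have e1 : spinOp n 1 = (-Complex.I / 2) • (spinPlus n - (spinPlus n)ᴴ) := rfl
  have : spinOp n 2 * spinOp n 0 - spinOp n 0 * spinOp n 2 =
    (1 / 2 : ℂ) • ((spinOp n 2 * spinPlus n - spinPlus n * spinOp n 2) +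
      (spinOp n 2 * (spinPlus n)ᴴ - (spinPlus n)ᴴ * spinOp n 2)) := by
    rw [e0]; simp only [Matrix.mul_smul, Matrix.smul_mul, Matrix.mul_add, Matrix.add_mul]
    module
  rw [this, h1, h2, e1, smul_smul]
  have : Complex.I * (-Complex.I / 2) = 1 / 2 := by linear_combination (-1/2) * Complex.I_mul_I
  rw [this, sub_eq_add_neg]

theorem comm_zy (n : ℕ) :
    spinOp n 2 * spinOp n 1 - spinOp n 1 * spinOp n 2 = -(Complex.I • spinOp n 0) := by
  have h1 := comm_zp n
  have h2 := comm_zm n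
  have e0 : spinOp n 0 = (1 / 2 : ℂ) • (spinPlus n + (spinPlus n)ᴴ) := rfl
  have e1 : spinOp n 1 = (-Complex.I / 2) • (spinPlus n - (spinPlus n)ᴴ) := rfl
  have : spinOp n 2 * spinOp n 1 - spinOp n 1 * spinOp n 2 =
    (-Complex.I / 2) • ((spinOp n 2 * spinPlus n - spinPlus n * spinOp n 2) -
      (spinOp n 2 * (spinPlus n)ᴴ - (spinPlus n)ᴴ * spinOp n 2)) := by
    rw [e1]; simp only [Matrix.mul_smul, Matrix.smul_mul, Matrix.mul_sub, Matrix.sub_mul]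
    module
  rw [this, h1, h2, e0]
  module

theorem comm_xy (n : ℕ) :
    spinOp n 1 * spinOp n 0 - spinOp n 0 * spinOp n 1 = -(Complex.I • spinOp n 2) := by
  have h1 := comm_pm n
  have e0 : spinOp n 0 = (1 / 2 : ℂ) • (spinPlus n + (spinPlus n)ᴴ) := rfl
  have e1 : spinOp n 1 = (-Complex.I / 2) • (spinPlus n - (spinPlus n)ᴴ) := rfl
  have : spinOp n 1 * spinOp n 0 - spinOp n 0 * spinOp n 1 =
    (-Complex.I / 2) • (spinPlus n * (spinPlus n)ᴴ - (spinPlus n)ᴴ * spinPlus n) := by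
    rw [e0, e1]
    simp only [Matrix.mul_smul, Matrix.smul_mul, Matrix.mul_sub, Matrix.sub_mul, Matrix.mul_add,
      Matrix.add_mul]
    module
  rw [this, h1]
  module

section ODE

theorem exp_conj_cos_sin_aux {𝔸 : Type*} [NormedRing 𝔸] [NormedAlgebra ℂ 𝔸] [CompleteSpace 𝔸]
    (H A B : 𝔸) (hA : H * A - A * H = Complex.I • B) (hB : H * B - B * H = -(Complex.I • A))
    (t : ℂ) :
    NormedSpace.exp (t • (-(Complex.I • H))) * A * NormedSpace.exp (t • (Complex.I • H)) =
      Complex.cos t • A + Complex.sin t • B := by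
  let _ : NormedAlgebra ℚ 𝔸 := NormedAlgebra.restrictScalars ℚ ℂ 𝔸
  set X : 𝔸 := Complex.I • H with hX
  have hc1 : X * A - A * X = -B := by
    rw [hX, smul_mul_assoc, mul_smul_comm, ← smul_sub, hA, smul_smul, Complex.I_mul_I]; simp
  have hc2 : X * B - B * X = A := by
    rw [hX, smul_mul_assoc, mul_smul_comm, ← smul_sub, hB, smul_neg, smul_smul,
      Complex.I_mul_I]; simp
  have hd1 : ∀ s : ℂ, HasDerivAt (fun s : ℂ => NormedSpace.exp (s • X))
      (NormedSpace.exp (s • X) * X) s := fun s => hasDerivAt_exp_smul_const X s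
  have hd2 : ∀ s : ℂ, HasDerivAt (fun s : ℂ => NormedSpace.exp (s • (-X)))
      (-X * NormedSpace.exp (s • (-X))) s := fun s => hasDerivAt_exp_smul_const' (-X) s
  have hinv' : ∀ s : ℂ, NormedSpace.exp (s • (-X)) * NormedSpace.exp (s • X) = 1 := by
    intro s
    rw [← NormedSpace.exp_add_of_commute]
    · simp
    · rw [smul_neg]; exact (Commute.refl _).neg_left
  have hcos : ∀ s : ℂ, HasDerivAt (fun s : ℂ => Complex.cos s • A + Complex.sin s • B)
      ((-Complex.sin s) • A + Complex.cos s • B) s := fun s =>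
    ((Complex.hasDerivAt_cos s).smul_const A).add ((Complex.hasDerivAt_sin s).smul_const B)
  have hconst : ∀ s : ℂ, HasDerivAt (fun s : ℂ => NormedSpace.exp (s • X) *
      (Complex.cos s • A + Complex.sin s • B) * NormedSpace.exp (s • (-X))) 0 s := by
    intro s
    have h := ((hd1 s).mul (hcos s)).mul (hd2 s)
    have key : X * (Complex.cos s • A + Complex.sin s • B) -
        (Complex.cos s • A + Complex.sin s • B) * X
        + ((-Complex.sin s) • A + Complex.cos s • B) = 0 := by
      have : X * (Complex.cos s • A + Complex.sin s • B) -
          (Complex.cos s • A + Complex.sin s • B) * X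
          = Complex.cos s • (X * A - A * X) + Complex.sin s • (X * B - B * X) := by
        simp only [mul_add, add_mul, mul_smul_comm, smul_mul_assoc]; module
      rw [this, hc1, hc2]; module
    have e : ∀ (P Q Y D : 𝔸), (P * X * Y + P * D) * Q + P * Y * (-X * Q) =
        P * (X * Y - Y * X + D) * Q := by intros; noncomm_ring
    refine h.congr_deriv ?_
    simp only [Pi.mul_apply]
    rw [e, key]; simp
  have heq := is_const_of_deriv_eq_zero (fun s => (hconst s).differentiableAt)
    (fun s => (hconst s).deriv) t 0
  simp only [Complex.cos_zero, Complex.sin_zero, zero_smul, NormedSpace.exp_zero, one_smul,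
    add_zero, mul_one, one_mul] at heq
  have e : ∀ (P Q Y : 𝔸), Q * (P * Y * Q) * P = (Q * P) * Y * (Q * P) := by
    intros; noncomm_ring
  conv_lhs => rw [← heq]
  rw [e, hinv', one_mul, mul_one]

attribute [local instance] Matrix.linftyOpNormedRing Matrix.linftyOpNormedAlgebra in
theorem exp_conj_cos_sin {m : Type*} [Fintype m] [DecidableEq m]
    (H A B : Matrix m m ℂ) (hA : H * A - A * H = Complex.I • B)
    (hB : H * B - B * H = -(Complex.I • A)) (t : ℂ) :
    NormedSpace.exp (t • (-(Complex.I • H))) * A * NormedSpace.exp (t • (Complex.I • H)) =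
      Complex.cos t • A + Complex.sin t • B :=
  exp_conj_cos_sin_aux H A B hA hB t

theorem exp_neg_mul_exp {m : Type*} [Fintype m] [DecidableEq m] (H : Matrix m m ℂ) (t : ℂ) :
    NormedSpace.exp (t • (-(Complex.I • H))) * NormedSpace.exp (t • (Complex.I • H)) = 1 := by
  rw [← Matrix.exp_add_of_commute]
  · simp
  · rw [smul_neg]; exact (Commute.refl _).neg_left

theorem exp_fix {m : Type*} [Fintype m] [DecidableEq m] (H : Matrix m m ℂ) (t : ℂ) :
    NormedSpace.exp (t • (-(Complex.I • H))) * H * NormedSpace.exp (t • (Complex.I • H)) = H := by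
  have hc : Commute (t • (Complex.I • H)) H :=
    ((Commute.refl H).smul_left Complex.I).smul_left t
  have hc' : Commute H (NormedSpace.exp (t • (Complex.I • H))) := hc.symm.exp_right
  rw [mul_assoc, hc'.eq, ← mul_assoc, exp_neg_mul_exp, one_mul]

end ODE

theorem exp_adj {m : Type*} [Fintype m] [DecidableEq m] (H : Matrix m m ℂ) (hH : Hᴴ = H) (t : ℝ) :
    (NormedSpace.exp ((t : ℂ) • (-(Complex.I • H))))ᴴ =
      NormedSpace.exp ((t : ℂ) • (Complex.I • H)) := by
  rw [← Matrix.exp_conjTranspose]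
  congr 1
  simp [Matrix.conjTranspose_smul, hH]

theorem exp_unitary {m : Type*} [Fintype m] [DecidableEq m] (H : Matrix m m ℂ) (hH : Hᴴ = H)
    (t : ℝ) : NormedSpace.exp ((t : ℂ) • (-(Complex.I • H))) ∈ Matrix.unitaryGroup m ℂ := by
  rw [Matrix.mem_unitaryGroup_iff, Matrix.star_eq_conjTranspose, exp_adj H hH, exp_neg_mul_exp]

/-- The rotation about the `z` axis by the angle `t`. -/
def rotZ (t : ℝ) : Matrix (Fin 3) (Fin 3) ℝ :=
  !![Real.cos t, -Real.sin t, 0; Real.sin t, Real.cos t, 0; 0, 0, 1]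

/-- The rotation about the `y` axis by the angle `t`. -/
def rotY (t : ℝ) : Matrix (Fin 3) (Fin 3) ℝ :=
  !![Real.cos t, 0, Real.sin t; 0, 1, 0; -Real.sin t, 0, Real.cos t]

theorem represents_rotZ (n : ℕ) (t : ℝ) :
    Represents n (rotZ t) (NormedSpace.exp ((t : ℂ) • (-(Complex.I • spinOp n 2)))) := by
  refine ⟨exp_unitary _ (spinOp_two_herm n) t, fun k => ?_⟩
  rw [exp_adj _ (spinOp_two_herm n), Fin.sum_univ_three]
  have h1 := comm_zx n
  have h2 := comm_zy n
  fin_cases k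
  · refine (exp_conj_cos_sin _ _ _ h1 h2 t).trans ?_
    simp [rotZ]
  · refine (exp_conj_cos_sin (spinOp n 2) (spinOp n 1) (-spinOp n 0)
      (by rw [h2, smul_neg]) ?_ t).trans ?_
    · rw [← h1]; noncomm_ring
    · simp [rotZ]; abel
  · refine (exp_fix _ _).trans ?_
    simp [rotZ]

theorem represents_rotY (n : ℕ) (t : ℝ) :
    Represents n (rotY t) (NormedSpace.exp ((t : ℂ) • (-(Complex.I • spinOp n 1)))) := by
  refine ⟨exp_unitary _ (spinOp_one_herm n) t, fun k => ?_⟩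
  rw [exp_adj _ (spinOp_one_herm n), Fin.sum_univ_three]
  have h1 : spinOp n 1 * spinOp n 2 - spinOp n 2 * spinOp n 1 = Complex.I • spinOp n 0 := by
    rw [← neg_sub, comm_zy, neg_neg]
  have h2 := comm_xy n
  fin_cases k
  · refine (exp_conj_cos_sin (spinOp n 1) (spinOp n 0) (-spinOp n 2)
      (by rw [h2, smul_neg]) ?_ t).trans ?_
    · rw [← h1]; noncomm_ring
    · simp [rotY]
  · refine (exp_fix _ _).trans ?_
    simp [rotY]
  · refine (exp_conj_cos_sin _ _ _ h1 h2 t).trans ?_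
    simp [rotY]; abel

theorem Represents.mul {n : ℕ} {R S : Matrix (Fin 3) (Fin 3) ℝ}
    {U V : Matrix (Fin (n + 1)) (Fin (n + 1)) ℂ} (hU : Represents n R U)
    (hV : Represents n S V) : Represents n (R * S) (U * V) := by
  refine ⟨mul_mem hU.1 hV.1, fun k => ?_⟩
  have e : U * V * spinOp n k * (U * V)ᴴ = U * (V * spinOp n k * Vᴴ) * Uᴴ := by
    rw [Matrix.conjTranspose_mul]; noncomm_ring
  rw [e, hV.2, Finset.mul_sum, Finset.sum_mul]
  simp only [Matrix.mul_smul, Matrix.smul_mul, hU.2, Matrix.mul_apply, Finset.smul_sum]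
  rw [Finset.sum_comm]
  refine Finset.sum_congr rfl fun l _ => ?_
  push_cast
  rw [Finset.sum_smul]
  refine Finset.sum_congr rfl fun j _ => ?_
  rw [smul_smul, mul_comm]

theorem exists_angle (a b : ℝ) : ∃ t : ℝ, a = √(a ^ 2 + b ^ 2) * Real.cos t ∧
    b = √(a ^ 2 + b ^ 2) * Real.sin t := by
  refine ⟨Complex.arg ⟨a, b⟩, ?_, ?_⟩
  · have := Complex.norm_mul_cos_arg ⟨a, b⟩
    rw [Complex.norm_eq_sqrt_sq_add_sq] at this
    exact this.symm
  · have := Complex.norm_mul_sin_arg ⟨a, b⟩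
    rw [Complex.norm_eq_sqrt_sq_add_sq] at this
    exact this.symm

/-- Euler angles. -/
theorem exists_euler (R : Matrix (Fin 3) (Fin 3) ℝ)
    (hR : R ∈ Matrix.specialOrthogonalGroup (Fin 3) ℝ) :
    ∃ a b c : ℝ, R = rotZ a * rotY b * rotZ c := by
  rw [Matrix.mem_specialOrthogonalGroup_iff] at hR
  obtain ⟨hO, hdet⟩ := hR
  have hRR : Rᵀ * R = 1 := by
    exact (Matrix.mem_orthogonalGroup_iff' (Fin 3) ℝ).1 hO
  have hu : R 0 2 ^ 2 + R 1 2 ^ 2 + R 2 2 ^ 2 = 1 := by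
    have := congrFun (congrFun hRR 2) 2
    simp [Matrix.mul_apply, Fin.sum_univ_three] at this
    nlinarith
  obtain ⟨a, ha1, ha2⟩ := exists_angle (R 0 2) (R 1 2)
  obtain ⟨b, hb1, hb2⟩ := exists_angle (R 2 2) (√(R 0 2 ^ 2 + R 1 2 ^ 2))
  have hs : R 2 2 ^ 2 + √(R 0 2 ^ 2 + R 1 2 ^ 2) ^ 2 = 1 := by
    rw [Real.sq_sqrt (by positivity)]; linarith
  rw [hs, Real.sqrt_one, one_mul] at hb1 hb2
  rw [hb2] at ha1 ha2
  have hca := Real.sin_sq_add_cos_sq a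
  have hcb := Real.sin_sq_add_cos_sq b
  have hza : rotZ a * rotZ (-a) = 1 := by
    ext i j
    fin_cases i <;> fin_cases j <;> simp [rotZ, Matrix.mul_apply, Fin.sum_univ_three] <;>
      linarith
  have hyb : rotY b * rotY (-b) = 1 := by
    ext i j
    fin_cases i <;> fin_cases j <;> simp [rotY, Matrix.mul_apply, Fin.sum_univ_three] <;>
      linarith
  have tz : ∀ t, (rotZ t)ᵀ = rotZ (-t) := by
    intro t; ext i j; fin_cases i <;> fin_cases j <;> simp [rotZ]
  have ty : ∀ t, (rotY t)ᵀ = rotY (-t) := by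
    intro t; ext i j; fin_cases i <;> fin_cases j <;> simp [rotY]
  have dz : ∀ t, (rotZ t).det = 1 := by
    intro t; rw [Matrix.det_fin_three]; simp [rotZ]; nlinarith [Real.sin_sq_add_cos_sq t]
  have dy : ∀ t, (rotY t).det = 1 := by
    intro t; rw [Matrix.det_fin_three]; simp [rotY]; nlinarith [Real.sin_sq_add_cos_sq t]
  set Q := rotY (-b) * (rotZ (-a) * R) with hQ
  have hRQ : R = rotZ a * rotY b * Q := by
    have : rotZ a * rotY b * (rotY (-b) * (rotZ (-a) * R)) =
        rotZ a * (rotY b * rotY (-b)) * rotZ (-a) * R := by noncomm_ring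
    rw [hQ, this, hyb, mul_one, hza, one_mul]
  have hQQ : Qᵀ * Q = 1 := by
    have : Qᵀ * Q = Rᵀ * (rotZ a * (rotY b * rotY (-b)) * rotZ (-a)) * R := by
      rw [hQ, Matrix.transpose_mul, Matrix.transpose_mul, tz, ty, neg_neg, neg_neg]; noncomm_ring
    rw [this, hyb, mul_one, hza, mul_one, hRR]
  have hQd : Q.det = 1 := by rw [hQ, Matrix.det_mul, Matrix.det_mul, dy, dz, hdet]; norm_num
  have q02 : Q 0 2 = 0 := by
    rw [hQ]
    simp [rotY, rotZ, Matrix.mul_apply, Fin.sum_univ_three, Matrix.vecMul, dotProduct]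
    rw [ha1, ha2, hb1]; linear_combination (Real.cos b * Real.sin b) * hca
  have q12 : Q 1 2 = 0 := by
    rw [hQ]
    simp [rotY, rotZ, Matrix.mul_apply, Fin.sum_univ_three, Matrix.vecMul, dotProduct]
    rw [ha1, ha2]; ring
  have q22 : Q 2 2 = 1 := by
    rw [hQ]
    simp [rotY, rotZ, Matrix.mul_apply, Fin.sum_univ_three, Matrix.vecMul, dotProduct]
    rw [ha1, ha2, hb1]; linear_combination (Real.sin b ^ 2) * hca + hcb
  have hent : ∀ i j, Q 0 i * Q 0 j + Q 1 i * Q 1 j + Q 2 i * Q 2 j =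
      (1 : Matrix (Fin 3) (Fin 3) ℝ) i j := by
    intro i j
    have := congrFun (congrFun hQQ i) j
    rwa [Matrix.mul_apply, Fin.sum_univ_three] at this
  have q20 : Q 2 0 = 0 := by simpa [q02, q12, q22] using hent 0 2
  have q21 : Q 2 1 = 0 := by simpa [q02, q12, q22] using hent 1 2
  have h00 : Q 0 0 * Q 0 0 + Q 1 0 * Q 1 0 = 1 := by simpa [q20] using hent 0 0
  have h01 : Q 0 0 * Q 0 1 + Q 1 0 * Q 1 1 = 0 := by simpa [q20, q21] using hent 0 1
  have hd : Q 0 0 * Q 1 1 - Q 0 1 * Q 1 0 = 1 := by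
    rw [Matrix.det_fin_three] at hQd
    simpa [q02, q12, q22, q20, q21] using hQd
  have q11 : Q 1 1 = Q 0 0 := by
    linear_combination (-Q 1 1) * h00 + Q 1 0 * h01 + Q 0 0 * hd
  have q01 : Q 0 1 = -Q 1 0 := by
    linear_combination (-Q 0 1) * h00 + Q 0 0 * h01 - Q 1 0 * hd
  obtain ⟨c, hc1, hc2⟩ := exists_angle (Q 0 0) (Q 1 0)
  have : Q 0 0 ^ 2 + Q 1 0 ^ 2 = 1 := by linarith [h00]
  rw [this, Real.sqrt_one, one_mul] at hc1 hc2
  refine ⟨a, b, c, ?_⟩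
  rw [hRQ]
  congr 1
  ext i j
  fin_cases i <;> fin_cases j <;> simp [rotZ, q02, q12, q22, q20, q21, q11, q01, hc1, hc2]

/-- Every rotation is represented on every spin. -/
theorem exists_represents (n : ℕ) (g : SO3) : ∃ U, Represents n g.1 U := by
  obtain ⟨a, b, c, h⟩ := exists_euler g.1 g.2
  rw [h]
  exact ⟨_, ((represents_rotZ n a).mul (represents_rotY n b)).mul (represents_rotZ n c)⟩

/-- The unitary matrix `U_{g,J}` that represents the rotation `g` on a spin-`J` particle,
`J = n / 2` (for some choice of its phase, which is physically irrelevant). -/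
def rotationUnitary (n : ℕ) (g : SO3) : Matrix (Fin (n + 1)) (Fin (n + 1)) ℂ :=
  (exists_represents n g).choose

/-! ### The normalized Haar measure of `SO(3)` -/

instance instIsTopologicalGroupSO3 : IsTopologicalGroup SO3 where
  continuous_mul := continuous_mul
  continuous_inv := by
    refine Continuous.subtype_mk (f := fun g : SO3 => star g.1) ?_ _
    exact continuous_star.comp continuous_subtype_val

instance instCompactSpaceSO3 : CompactSpace SO3 := by
  refine isCompact_iff_compactSpace.1 (IsCompact.of_isClosed_subset
    (s := Set.univ.pi fun _ : Fin 3 => Set.univ.pi fun _ : Fin 3 => Set.Icc (-1 : ℝ) 1)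
    (isCompact_univ_pi fun _ => isCompact_univ_pi fun _ => isCompact_Icc) ?_ ?_)
  · have h : ((Matrix.specialOrthogonalGroup (Fin 3) ℝ : Submonoid _) :
        Set (Matrix (Fin 3) (Fin 3) ℝ)) = {A | Aᵀ * A = 1} ∩ {A | A.det = 1} := by
      ext A
      simp only [SetLike.mem_coe, Matrix.mem_specialOrthogonalGroup_iff,
        Matrix.mem_orthogonalGroup_iff' (Fin 3) ℝ, Set.mem_inter_iff, Set.mem_ofPred_eq]
    rw [h]
    refine IsClosed.inter (isClosed_eq ?_ continuous_const) (isClosed_eq ?_ continuous_const)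
    · exact (continuous_id.matrix_transpose).matrix_mul continuous_id
    · exact continuous_id.matrix_det
  · intro A hA i _ j _
    have h1 := (Matrix.mem_orthogonalGroup_iff' (Fin 3) ℝ).1
      (Matrix.mem_specialOrthogonalGroup_iff.1 hA).1
    have h2 := congrFun (congrFun h1 j) j
    simp only [Matrix.one_apply_eq] at h2
    have h3 : A i j * A i j ≤ 1 := by
      rw [← h2]
      exact Finset.single_le_sum (f := fun k => A k j * A k j)
        (fun k _ => mul_self_nonneg _) (Finset.mem_univ i)
    exact ⟨by nlinarith, by nlinarith⟩

instance instMeasurableSpaceSO3 : MeasurableSpace SO3 := borel SO3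

instance instBorelSpaceSO3 : BorelSpace SO3 := ⟨rfl⟩

/-- The Haar measure `dg` of `SO(3)`, normalized to total mass `1`. -/
def haarSO3 : Measure SO3 := Measure.haarMeasure ⊤

/-! ### Bell states -/

/-- The standard Bell state `|Φ_J⟩ = (2 J + 1)^(-1/2) ∑ m, |J, m⟩ ⊗ |J, m⟩`. -/
def bell (n : ℕ) : Fin (n + 1) × Fin (n + 1) → ℂ :=
  fun p => if p.1 = p.2 then (((√(2 * spin n + 1))⁻¹ : ℝ) : ℂ) else 0

/-- The rotated Bell state `|Φ_{g,J}⟩ = (U_{g,J} ⊗ I) |Φ_J⟩`. -/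
def rotatedBell (n : ℕ) (g : SO3) : Fin (n + 1) × Fin (n + 1) → ℂ :=
  Matrix.kroneckerMap (· * ·) (rotationUnitary n g) 1 *ᵥ bell n

/-- The tensor power `|ψ⟩^{⊗ M}`. -/
def tensorPower {ι : Type} (M : ℕ) (ψ : ι → ℂ) : (Fin M → ι) → ℂ :=
  fun f => ∏ k, ψ (f k)

/-- `M` Cartesian refbits, that is, `M` copies of the spin-`1/2` Bell state `|Φ_{g,1/2}⟩`. -/
def refbits (M : ℕ) (g : SO3) : (Fin M → Fin 2 × Fin 2) → ℂ :=
  tensorPower M (rotatedBell 1 g)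

/-! ### Machines -/

section Machines

variable {ι κ : Type} [Fintype ι] [Fintype κ] [DecidableEq ι] [DecidableEq κ]

/-- The rank one operator `|ψ⟩⟨ψ|`. -/
def proj (ψ : ι → ℂ) : CStarMatrix ι ι ℂ :=
  CStarMatrix.ofMatrix (Matrix.vecMulVec ψ (star ψ))

/-- The trace of an operator. -/
def tr (A : CStarMatrix ι ι ℂ) : ℂ := (CStarMatrix.ofMatrix.symm A).trace

/-- The (real) expectation value `⟨ψ|A|ψ⟩`. -/
def expVal (A : CStarMatrix ι ι ℂ) (ψ : ι → ℂ) : ℝ :=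
  (star ψ ⬝ᵥ (CStarMatrix.ofMatrix.symm A *ᵥ ψ)).re

/-- A deterministic machine is a quantum channel: a completely positive, trace-preserving map. -/
def IsChannel (C : CompletelyPositiveMap (CStarMatrix ι ι ℂ) (CStarMatrix κ κ ℂ)) : Prop :=
  ∀ A, tr (C A) = tr A

/-- A probabilistic machine is a quantum operation: a completely positive map that does not
increase the trace of positive operators. -/
def IsOperation (C : CompletelyPositiveMap (CStarMatrix ι ι ℂ) (CStarMatrix κ κ ℂ)) : Prop :=
  ∀ A, 0 ≤ A → (tr (C A)).re ≤ (tr A).re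

end Machines

/-- Completely positive maps from the operators on a pair of spin-`n / 2` particles to the operators
on `M` pairs of spin-`1/2` particles. -/
abbrev AnalyserMap (n M : ℕ) :=
  CompletelyPositiveMap
    (CStarMatrix (Fin (n + 1) × Fin (n + 1)) (Fin (n + 1) × Fin (n + 1)) ℂ)
    (CStarMatrix (Fin M → Fin 2 × Fin 2) (Fin M → Fin 2 × Fin 2) ℂ)

/-- The overlap `⟨Φ_{g,1/2}|^{⊗ M} C(|Φ_{g,J}⟩⟨Φ_{g,J}|) |Φ_{g,1/2}⟩^{⊗ M}` of the output for the
rotation `g` with `M` refbits. -/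
def overlap (n M : ℕ) (C : AnalyserMap n M) (g : SO3) : ℝ :=
  expVal (C (proj (rotatedBell n g))) (refbits M g)

/-- The probability of success `p(succ|g) = Tr C(|Φ_{g,J}⟩⟨Φ_{g,J}|)`. -/
def successProbAt (n M : ℕ) (C : AnalyserMap n M) (g : SO3) : ℝ :=
  (tr (C (proj (rotatedBell n g)))).re

/-- The total success probability `∫ dg p(succ|g)`. -/
def successProb (n M : ℕ) (C : AnalyserMap n M) : ℝ :=
  ∫ g, successProbAt n M C g ∂haarSO3

/-- The average fidelity of a deterministic machine. -/
def detFidelity (n M : ℕ) (C : AnalyserMap n M) : ℝ :=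
  ∫ g, overlap n M C g ∂haarSO3

/-- The average fidelity of a probabilistic machine, conditional on success. -/
def probFidelity (n M : ℕ) (C : AnalyserMap n M) : ℝ :=
  (∫ g, overlap n M C g ∂haarSO3) / successProb n M C

end SpinBell

end

noncomputable section

namespace SpinBell

/-! ### Kraus form of completely positive maps. -/

section Kraus

/-! Write `n = 2J`. By `exists_kraus`, on pure states a completely positive map is a sum of terms `K
φ φ* K*`. Both the average overlap and the success probability are sums over the Kraus operators
`K`, so it is enough to compare the two contributions of a single `K`. Each is measured against the
Hilbert-Schmidt norm `‖K‖²`.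

Success probability: the Bell state is the normalized vectorization of the irreducible unitary
`U_{g,J}`, so Schur orthogonality gives exactly `‖K‖² / (n + 1)²`. One factor `n + 1` is the
normalization of the state, the other the dimension of the representation
(`integral_normSq_mulVec`).

Overlap: Cauchy-Schwarz on all refbits but the first reduces to one refbit, with `K` cut into slices
whose squared norms add up to `‖K‖²` (`normSq_dotProduct_tensorPower_le`). For one refbit the
amplitude is a matrix coefficient `Tr (B W_g)` of `W = Ū_{1/2} ⊗ U_J`, up to the factor `(2(n +
1))^(-1/2)`, where `B` has the same entries as the slice. Now `W` is the sum of two inequivalent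
irreducible components, of spins `J - 1/2` and `J + 1/2` and dimensions `n` and `n + 2`. By Schur
orthogonality the mean square of `Tr (B W_g)` is at most `‖B‖² / n`, the smaller dimension being the
worse (`integral_pairUnitary_le`). Hence the overlap is at most `‖K‖² / (2n(n + 1))`.

The quotient of the two is `(n + 1) / (2n) = (1 + 1/(2J)) / 2`.

Schur's lemma for `W` is obtained infinitesimally: an operator commuting with `W` commutes with the
total angular momentum, and these operators are spanned by `1` and the spin-orbit operator, which
has two eigenvalues. The unitaries `U_{g,J}` carry arbitrary phases, so they need not be continuous
in `g`; only combinations in which the phases cancel are integrated. -/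

theorem exists_star_mul_self_of_nonneg {B : Type*} [NonUnitalCStarAlgebra B] [PartialOrder B]
    [StarOrderedRing B] {x : B} (hx : 0 ≤ x) : ∃ y, x = star y * y :=
  CStarAlgebra.nonneg_iff_eq_star_mul_self.1 hx

theorem sum_comm₄ {α β γ δ R : Type*} [Fintype α] [Fintype β] [Fintype γ] [Fintype δ]
    [AddCommMonoid R] (f : α → β → γ → δ → R) :
    ∑ a, ∑ b, ∑ c, ∑ d, f a b c d = ∑ c, ∑ d, ∑ a, ∑ b, f a b c d := by
  simp only [← Fintype.sum_prod_type']
  exact Fintype.sum_equiv ⟨fun p => (p.2.2.1, p.2.2.2, p.1, p.2.1),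
    fun p => (p.2.2.1, p.2.2.2, p.1, p.2.1), fun _ => rfl, fun _ => rfl⟩ _ _ fun _ => rfl

variable {ι κ : Type} [Fintype ι] [Fintype κ] [DecidableEq ι]

/-- The unnormalized maximally entangled operator `∑ a b, |a⟩⟨b| ⊗ |a⟩⟨b|`, as a block matrix. -/
def matrixUnits (ι : Type) [DecidableEq ι] : CStarMatrix ι ι (CStarMatrix ι ι ℂ) :=
  CStarMatrix.ofMatrix (Matrix.of fun a b => CStarMatrix.ofMatrix (Matrix.single a b 1))

theorem matrixUnits_nonneg : 0 ≤ matrixUnits ι := by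
  rcases isEmpty_or_nonempty ι with h | ⟨⟨i₀⟩⟩
  · exact le_of_eq (CStarMatrix.ext fun i => h.elim i)
  -- A square root with a single nonzero row: since `|a⟩⟨b| = |i₀⟩⟨a|* |i₀⟩⟨b|`, one row of matrix
  -- units suffices.
  let E : CStarMatrix ι ι (CStarMatrix ι ι ℂ) :=
    CStarMatrix.ofMatrix (Matrix.of fun a b => if a = i₀ then
        CStarMatrix.ofMatrix (Matrix.single i₀ b (1 : ℂ)) else 0)
  have hE : ∀ b, E i₀ b = CStarMatrix.ofMatrix (Matrix.single i₀ b (1 : ℂ)) := fun b => if_pos rfl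
  have hE' : ∀ a b, a ≠ i₀ → E a b = 0 := fun a b h => if_neg h
  have : matrixUnits ι = star E * E := by
    refine CStarMatrix.ext fun a b => ?_
    rw [CStarMatrix.mul_apply, Finset.sum_eq_single i₀]
    · rw [CStarMatrix.star_apply, hE, hE]
      change Matrix.single a b (1 : ℂ) =
        (Matrix.single i₀ a (1 : ℂ))ᴴ * (Matrix.single i₀ b (1 : ℂ))
      simp
    · intro c _ hc
      rw [hE' c b hc, mul_zero]
    · simp
  rw [this]
  exact star_mul_self_nonneg _

/-- The Kraus form of a completely positive map, on rank one operators. -/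
theorem exists_kraus (C : CompletelyPositiveMap (CStarMatrix ι ι ℂ) (CStarMatrix κ κ ℂ)) :
    ∃ K : ι × κ → Matrix κ ι ℂ, ∀ φ : ι → ℂ, CStarMatrix.ofMatrix.symm (C (proj φ)) =
      ∑ s, Matrix.vecMulVec (K s *ᵥ φ) (star (K s *ᵥ φ)) := by
  -- Choi's argument: complete positivity makes the image of the maximally entangled operator
  -- positive, hence of the form `a* a`. The Kraus operators are the conjugated rows of `a`.
  have h := CompletelyPositiveMap.map_cstarMatrix_nonneg C _ (matrixUnits_nonneg (ι := ι))
  obtain ⟨a, ha⟩ := exists_star_mul_self_of_nonneg (B := CStarMatrix ι ι (CStarMatrix κ κ ℂ)) h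
  have hab : ∀ i j x y, C (CStarMatrix.ofMatrix (Matrix.single i j 1)) x y =
      ∑ c, ∑ z, star (a c i z x) * a c j z y := by
    intro i j x y
    have h1 : C (CStarMatrix.ofMatrix (Matrix.single i j 1)) = (star a * a) i j := by
      rw [← ha]; rfl
    have h2 : ∀ (s : Finset ι) (f : ι → CStarMatrix κ κ ℂ), (∑ c ∈ s, f c) x y =
        ∑ c ∈ s, f c x y := fun s f => by
      classical
      induction s using Finset.induction_on with
      | empty => simp
      | insert c s hc ih => rw [Finset.sum_insert hc, Finset.sum_insert hc, ← ih]; rfl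
    rw [h1, CStarMatrix.mul_apply, h2]
    rfl
  refine ⟨fun s => Matrix.of fun x i => star (a s.1 i s.2 x), fun φ => ?_⟩
  have hp : proj φ = ∑ i, ∑ j, (φ i * star (φ j)) •
      (CStarMatrix.ofMatrix (Matrix.single i j 1) : CStarMatrix ι ι ℂ) := by
    change Matrix.vecMulVec φ (star φ) = ∑ i, ∑ j, (φ i * star (φ j)) • Matrix.single i j (1 : ℂ)
    conv_lhs => rw [Matrix.matrix_eq_sum_single (Matrix.vecMulVec φ (star φ))]
    simp [Matrix.vecMulVec_apply]
  have hC : CStarMatrix.ofMatrix.symm (C (proj φ)) = ∑ i, ∑ j, (φ i * star (φ j)) •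
      (CStarMatrix.ofMatrix.symm (C (CStarMatrix.ofMatrix (Matrix.single i j 1)))) := by
    rw [hp]
    simp only [map_sum, map_smul]
    rfl
  rw [hC]
  ext x y
  simp only [Matrix.sum_apply, Matrix.smul_apply, CStarMatrix.ofMatrix_symm_apply, hab,
    Matrix.vecMulVec_apply, Matrix.mulVec, dotProduct, Matrix.of_apply, Pi.star_apply,
    star_sum, star_mul, star_star, smul_eq_mul, Fintype.sum_prod_type]
  simp only [Finset.sum_mul_sum]
  simp only [Finset.mul_sum]
  rw [sum_comm₄]
  refine Finset.sum_congr rfl fun c _ => Finset.sum_congr rfl fun z _ =>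
    Finset.sum_congr rfl fun i _ => Finset.sum_congr rfl fun j _ => ?_
  ring

end Kraus

/-! ### Haar averages over projective representations of `SO(3)`. -/

instance instIsProbabilityMeasureHaarSO3 : IsProbabilityMeasure haarSO3 :=
  ⟨Measure.haarMeasure_self (K₀ := (⊤ : TopologicalSpace.PositiveCompacts SO3))⟩

instance instIsMulLeftInvariantHaarSO3 : haarSO3.IsMulLeftInvariant :=
  Measure.isMulLeftInvariant_haarMeasure _

theorem integrable_of_continuous {E : Type*} [NormedAddCommGroup E] [SecondCountableTopologyEither SO3 E]
    {f : SO3 → E} (hf : Continuous f) : Integrable f haarSO3 :=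
  hf.integrable_of_hasCompactSupport (HasCompactSupport.of_compactSpace f)

/-- A projective unitary representation of `SO(3)` by matrices: a choice of unitary matrices,
multiplicative up to phases, with continuous adjoint action. -/
structure IsProjectiveRep {m : Type*} [Fintype m] [DecidableEq m] (W : SO3 → Matrix m m ℂ) :
    Prop where
  unitary : ∀ g, W g * (W g)ᴴ = 1
  map_mul : ∀ g h, ∃ c : ℂ, c * star c = 1 ∧ W (g * h) = c • (W g * W h)
  -- An entry times a conjugate entry does not depend on the phase of `W g`; a single entry does,
  -- and need not be continuous.
  continuous_entry : ∀ p q r s, Continuous fun g => W g p q * star (W g r s)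

namespace IsProjectiveRep

variable {m : Type*} [Fintype m] [DecidableEq m] {W : SO3 → Matrix m m ℂ}

/-- The average of `Y` over the adjoint action of the group. -/
def twirl (W : SO3 → Matrix m m ℂ) (Y : Matrix m m ℂ) : Matrix m m ℂ :=
  Matrix.of fun p q => ∫ g, (W g * Y * (W g)ᴴ) p q ∂haarSO3

theorem conj_apply {m : Type*} [Fintype m] (A Y : Matrix m m ℂ) (p q : m) :
    (A * Y * Aᴴ) p q = ∑ a, ∑ b, Y a b * (A p a * star (A q b)) := by
  simp only [Matrix.mul_apply, Finset.sum_mul, Matrix.conjTranspose_apply]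
  rw [Finset.sum_comm]
  exact Finset.sum_congr rfl fun _ _ => Finset.sum_congr rfl fun _ _ => by ring

/-- The matrix coefficients of a projective representation in terms of the twirl. -/
theorem integral_entry (p q r s : m) :
    ∫ g, W g p q * star (W g r s) ∂haarSO3 = twirl W (Matrix.single q s 1) p r := by
  change _ = ∫ g, (W g * (Matrix.single q s 1 : Matrix m m ℂ) * (W g)ᴴ) p r ∂haarSO3
  refine integral_congr_ae (Filter.Eventually.of_forall fun g => ?_)
  simp only [conj_apply]
  rw [Finset.sum_eq_single q, Finset.sum_eq_single s]
  · simp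
  · intro b _ hb; simp [Matrix.single, hb.symm]
  · simp
  · intro b _ hb; simp [Matrix.single, hb.symm]
  · simp

variable (hW : IsProjectiveRep W)
include hW

theorem continuous_conj (Y : Matrix m m ℂ) (p q : m) :
    Continuous fun g => (W g * Y * (W g)ᴴ) p q := by
  simp only [conj_apply]
  exact continuous_finsetSum _ fun a _ => continuous_finsetSum _ fun b _ =>
    continuous_const.mul (hW.continuous_entry p a q b)

theorem integrable_conj (Y : Matrix m m ℂ) (p q : m) :
    Integrable (fun g => (W g * Y * (W g)ᴴ) p q) haarSO3 :=
  integrable_of_continuous (hW.continuous_conj Y p q)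

theorem conj_mul (g h : SO3) (Y : Matrix m m ℂ) :
    W (g * h) * Y * (W (g * h))ᴴ = W g * (W h * Y * (W h)ᴴ) * (W g)ᴴ := by
  obtain ⟨c, hc, e⟩ := hW.map_mul g h
  rw [e, Matrix.conjTranspose_smul, Matrix.smul_mul, Matrix.smul_mul, Matrix.mul_smul, smul_smul,
    hc, one_smul, Matrix.conjTranspose_mul]
  simp only [Matrix.mul_assoc]

theorem unitary' (g : SO3) : (W g)ᴴ * W g = 1 := mul_eq_one_comm.1 (hW.unitary g)

/-- Left invariance of the Haar measure; the phase in `W (h * g)` cancels between `W` and its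
adjoint. -/
theorem conj_twirl (h : SO3) (Y : Matrix m m ℂ) : W h * twirl W Y * (W h)ᴴ = twirl W Y := by
  ext p q
  have e : ∀ a b, twirl W Y a b = ∫ g, (W g * Y * (W g)ᴴ) a b ∂haarSO3 := fun _ _ => rfl
  rw [e p q, ← integral_mul_left_eq_self _ h]
  simp only [hW.conj_mul]
  rw [conj_apply]
  simp only [conj_apply (W h)]
  rw [integral_finsetSum]
  · refine Finset.sum_congr rfl fun a _ => ?_
    rw [integral_finsetSum]
    · refine Finset.sum_congr rfl fun b _ => ?_
      rw [integral_mul_const, e]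
    · exact fun b _ => (hW.integrable_conj Y a b).mul_const _
  · exact fun a _ => integrable_finsetSum _ fun b _ => (hW.integrable_conj Y a b).mul_const _

theorem commute_twirl (h : SO3) (Y : Matrix m m ℂ) : Commute (W h) (twirl W Y) := by
  have := congrArg (· * W h) (hW.conj_twirl h Y)
  simp only [Matrix.mul_assoc, hW.unitary' h, Matrix.mul_one] at this
  exact this

/-- Conjugation by `W g` does not change a trace against an invariant operator. Once the commutant
is known, these traces determine the twirl. -/
theorem trace_mul_twirl {P : Matrix m m ℂ} (hP : ∀ g, Commute (W g) P) (Y : Matrix m m ℂ) :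
    (P * twirl W Y).trace = (P * Y).trace := by
  have h1 : ∀ g, (P * (W g * Y * (W g)ᴴ)).trace = (P * Y).trace := by
    intro g
    rw [← Matrix.mul_assoc, ← Matrix.mul_assoc, Matrix.trace_mul_comm, ← (hP g).eq,
      ← Matrix.mul_assoc, ← Matrix.mul_assoc, hW.unitary', Matrix.one_mul]
  have h2 : (P * twirl W Y).trace = ∫ g, (P * (W g * Y * (W g)ᴴ)).trace ∂haarSO3 := by
    have e : ∀ Z : Matrix m m ℂ, (P * Z).trace = ∑ a, ∑ b, P a b * Z b a := fun _ => rfl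
    simp only [e]
    rw [integral_finsetSum]
    · refine Finset.sum_congr rfl fun a _ => ?_
      rw [integral_finsetSum]
      · exact Finset.sum_congr rfl fun b _ => (integral_const_mul _ _).symm
      · exact fun b _ => (hW.integrable_conj Y b a).const_mul _
    · exact fun a _ => integrable_finsetSum _ fun b _ => (hW.integrable_conj Y b a).const_mul _
  rw [h2]
  simp [h1]

theorem trace_twirl (Y : Matrix m m ℂ) : (twirl W Y).trace = Y.trace := by
  simpa using hW.trace_mul_twirl (P := 1) (fun g => Commute.one_right _) Y

/-- Reduces the mean square of a matrix coefficient to twirls of matrix units, which Schur's lemma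
evaluates. -/
theorem integral_trace_mul_star (B : Matrix m m ℂ) :
    ∫ g, (B * W g).trace * star (B * W g).trace ∂haarSO3 =
      ∑ q, ∑ p, ∑ s, ∑ r, B q p * star (B s r) * twirl W (Matrix.single q s 1) p r := by
  have e : ∀ g, (B * W g).trace * star (B * W g).trace =
      ∑ q, ∑ p, ∑ s, ∑ r, B q p * star (B s r) * (W g p q * star (W g r s)) := by
    intro g
    simp only [Matrix.trace, Matrix.diag_apply, Matrix.mul_apply, star_sum, star_mul,
      Finset.sum_mul]
    refine Finset.sum_congr rfl fun q _ => Finset.sum_congr rfl fun p _ => ?_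
    simp only [Finset.mul_sum]
    exact Finset.sum_congr rfl fun _ _ => Finset.sum_congr rfl fun _ _ => by ring
  have hi : ∀ q p s r, Integrable
      (fun g => B q p * star (B s r) * (W g p q * star (W g r s))) haarSO3 :=
    fun q p s r => (integrable_of_continuous (hW.continuous_entry p q r s)).const_mul _
  simp only [e]
  rw [integral_finsetSum _ fun _ _ => integrable_finsetSum _ fun _ _ =>
    integrable_finsetSum _ fun _ _ => integrable_finsetSum _ fun _ _ => hi _ _ _ _]
  refine Finset.sum_congr rfl fun q _ => ?_
  rw [integral_finsetSum _ fun _ _ =>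
    integrable_finsetSum _ fun _ _ => integrable_finsetSum _ fun _ _ => hi _ _ _ _]
  refine Finset.sum_congr rfl fun p _ => ?_
  rw [integral_finsetSum _ fun _ _ => integrable_finsetSum _ fun _ _ => hi _ _ _ _]
  refine Finset.sum_congr rfl fun s _ => ?_
  rw [integral_finsetSum _ fun _ _ => hi _ _ _ _]
  refine Finset.sum_congr rfl fun r _ => ?_
  rw [integral_const_mul, integral_entry]

end IsProjectiveRep

/-! ### Irreducibility of the spin representations -/

theorem spinOp_two_apply (n : ℕ) (i j : Fin (n + 1)) :
    spinOp n 2 i j = if i = j then (mag n i : ℂ) else 0 := rfl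

theorem spinPlus_ne_zero {n : ℕ} {i j : Fin (n + 1)} (h : (j : ℕ) = i + 1) :
    spinPlus n i j ≠ 0 := by
  rw [spinPlus, Matrix.of_apply, if_pos h, Complex.ofReal_ne_zero, Real.sqrt_ne_zero']
  have h1 : ((i : ℕ) : ℝ) + 1 ≤ n := by exact_mod_cast (show (i : ℕ) + 1 ≤ n by omega)
  simp only [mag, spin, h]
  push_cast
  nlinarith [(Nat.cast_nonneg (i : ℕ) : (0 : ℝ) ≤ _)]

theorem spinPlus_eq_zero {n : ℕ} {i j : Fin (n + 1)} (h : (j : ℕ) ≠ i + 1) :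
    spinPlus n i j = 0 := if_neg h

theorem spinPlus_mul_apply {n : ℕ} {i j : Fin (n + 1)} (h : (j : ℕ) = i + 1)
    (X : Matrix (Fin (n + 1)) (Fin (n + 1)) ℂ) (k : Fin (n + 1)) :
    (spinPlus n * X) i k = spinPlus n i j * X j k := by
  rw [Matrix.mul_apply, Finset.sum_eq_single j]
  · intro b _ hb
    rw [spinPlus_eq_zero, zero_mul]
    intro hb'; exact hb (Fin.ext (by omega))
  · simp

theorem mul_spinPlus_apply {n : ℕ} {i j : Fin (n + 1)} (h : (j : ℕ) = i + 1)
    (X : Matrix (Fin (n + 1)) (Fin (n + 1)) ℂ) (k : Fin (n + 1)) :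
    (X * spinPlus n) k j = X k i * spinPlus n i j := by
  rw [Matrix.mul_apply, Finset.sum_eq_single i]
  · intro b _ hb
    rw [spinPlus_eq_zero, mul_zero]
    intro hb'; exact hb (Fin.ext (by omega))
  · simp

theorem spinOp_two_mul_apply {n : ℕ} (X : Matrix (Fin (n + 1)) (Fin (n + 1)) ℂ)
    (i j : Fin (n + 1)) : (spinOp n 2 * X) i j = mag n i * X i j := by
  simp only [spinOp, Matrix.cons_val, Matrix.diagonal_mul]

theorem mul_spinOp_two_apply {n : ℕ} (X : Matrix (Fin (n + 1)) (Fin (n + 1)) ℂ)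
    (i j : Fin (n + 1)) : (X * spinOp n 2) i j = X i j * mag n j := by
  simp only [spinOp, Matrix.cons_val, Matrix.mul_diagonal]

/-- The spin representation is irreducible: an operator that commutes with `J_z` and `J₊` is a
scalar. -/
theorem eq_smul_one_of_commute {n : ℕ} {X : Matrix (Fin (n + 1)) (Fin (n + 1)) ℂ}
    (hz : spinOp n 2 * X = X * spinOp n 2) (hp : spinPlus n * X = X * spinPlus n) :
    X = X 0 0 • (1 : Matrix (Fin (n + 1)) (Fin (n + 1)) ℂ) := by
  -- Commuting with `J₊` equates neighbouring diagonal entries; off the diagonal, the distinct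
  -- eigenvalues of `J_z` force zeros.
  have hdiag : ∀ i, X i i = X 0 0 := by
    intro i
    induction i using Fin.induction with
    | zero => rfl
    | succ i ih =>
      rw [← ih]
      have h : ((i.succ : Fin (n + 1)) : ℕ) = (i.castSucc : Fin (n + 1)) + 1 := by simp
      have := congrFun (congrFun hp i.castSucc) i.succ
      rw [spinPlus_mul_apply h, mul_spinPlus_apply h, mul_comm] at this
      exact mul_right_cancel₀ (spinPlus_ne_zero h) this
  ext i j
  rw [Matrix.smul_apply, Matrix.one_apply]
  split_ifs with hij
  · subst hij; simp [hdiag]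
  · have := congrFun (congrFun hz i) j
    rw [spinOp_two_mul_apply, mul_spinOp_two_apply, mul_comm, ← sub_eq_zero, ← mul_sub,
      mul_eq_zero] at this
    rcases this with h | h
    · simp [h]
    · refine absurd (Fin.ext ?_) hij
      simp only [mag] at h
      push_cast at h
      have : ((i : ℕ) : ℂ) = (j : ℕ) := by linear_combination -h
      exact_mod_cast this

/-- An operator that satisfies the commutation relations of `J₊` with `J_z` and `J₊` is a multiple
of `J₊`. -/
theorem exists_eq_smul_spinPlus {n : ℕ} {X : Matrix (Fin (n + 1)) (Fin (n + 1)) ℂ}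
    (hz : spinOp n 2 * X - X * spinOp n 2 = X) (hp : spinPlus n * X = X * spinPlus n) :
    ∃ β : ℂ, X = β • spinPlus n := by
  -- The relation with `J_z` says that `X` raises the weight by one, so `X` lives where `J₊` does.
  have hoff : ∀ i j : Fin (n + 1), (j : ℕ) ≠ i + 1 → X i j = 0 := by
    intro i j hij
    have := congrFun (congrFun hz i) j
    rw [Matrix.sub_apply, spinOp_two_mul_apply, mul_spinOp_two_apply] at this
    have h2 : X i j * (((mag n i : ℝ) : ℂ) - (mag n j : ℝ) - 1) = 0 := by linear_combination this
    refine (mul_eq_zero.1 h2).resolve_right fun h => hij ?_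
    simp only [mag] at h
    push_cast at h
    have : ((j : ℕ) : ℂ) = (i : ℕ) + 1 := by linear_combination h
    exact_mod_cast this
  rcases n with - | n
  · refine ⟨0, ?_⟩
    ext i j
    rw [hoff i j (by omega)]; simp
  refine ⟨X 0 1 / spinPlus (n + 1) 0 1, ?_⟩
  -- Commuting with `J₊` carries the ratio of `X` to `J₊` from one entry to the next; it is fixed by
  -- the first.
  have hval : ∀ k : Fin (n + 1), X k.castSucc k.succ =
      X 0 1 / spinPlus (n + 1) 0 1 * spinPlus (n + 1) k.castSucc k.succ := by
    intro k
    induction k using Fin.induction with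
    | zero =>
      have : spinPlus (n + 1) 0 1 ≠ 0 := spinPlus_ne_zero (by simp)
      change X 0 1 = X 0 1 / spinPlus (n + 1) 0 1 * spinPlus (n + 1) 0 1
      field_simp
    | succ i ih =>
      have h1 : ((i.castSucc.succ : Fin (n + 2)) : ℕ) =
        (i.castSucc.castSucc : Fin (n + 2)) + 1 := by simp
      have h2 : ((i.succ.succ : Fin (n + 2)) : ℕ) =
        (i.castSucc.succ : Fin (n + 2)) + 1 := by simp
      have h := congrFun (congrFun hp i.castSucc.castSucc) i.succ.succ
      rw [spinPlus_mul_apply h1, mul_spinPlus_apply h2, ih] at h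
      rw [Fin.castSucc_succ]
      refine mul_left_cancel₀ (spinPlus_ne_zero h1) ?_
      rw [h]; ring
  ext i j
  rw [Matrix.smul_apply, smul_eq_mul]
  by_cases hij : (j : ℕ) = i + 1
  · have hi : (i : ℕ) < n + 1 := by omega
    obtain rfl : j = (⟨i, hi⟩ : Fin (n + 1)).succ := Fin.ext hij
    exact hval ⟨i, hi⟩
  · rw [hoff i j hij, spinPlus_eq_zero hij, mul_zero]

theorem spinPlus_eq (n : ℕ) : spinPlus n = spinOp n 0 + Complex.I • spinOp n 1 := by
  have e0 : spinOp n 0 = (1 / 2 : ℂ) • (spinPlus n + (spinPlus n)ᴴ) := rfl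
  have e1 : spinOp n 1 = (-Complex.I / 2) • (spinPlus n - (spinPlus n)ᴴ) := rfl
  rw [e0, e1, smul_smul]
  have : Complex.I * (-Complex.I / 2) = 1 / 2 := by linear_combination (-1/2) * Complex.I_mul_I
  rw [this]; module

theorem conjTranspose_spinPlus_eq (n : ℕ) :
    (spinPlus n)ᴴ = spinOp n 0 - Complex.I • spinOp n 1 := by
  have e0 : spinOp n 0 = (1 / 2 : ℂ) • (spinPlus n + (spinPlus n)ᴴ) := rfl
  have e1 : spinOp n 1 = (-Complex.I / 2) • (spinPlus n - (spinPlus n)ᴴ) := rfl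
  rw [e0, e1, smul_smul]
  have : Complex.I * (-Complex.I / 2) = 1 / 2 := by linear_combination (-1/2) * Complex.I_mul_I
  rw [this]; module

theorem eq_smul_one_of_commute_spinOp {n : ℕ} {X : Matrix (Fin (n + 1)) (Fin (n + 1)) ℂ}
    (h : ∀ k, Commute (spinOp n k) X) :
    X = X 0 0 • (1 : Matrix (Fin (n + 1)) (Fin (n + 1)) ℂ) := by
  refine eq_smul_one_of_commute (h 2).eq ?_
  rw [spinPlus_eq]
  exact ((h 0).add_left ((h 1).smul_left _)).eq

/-- A rotation determines the unitary that represents it up to a phase. -/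
theorem Represents.exists_phase {n : ℕ} {R : Matrix (Fin 3) (Fin 3) ℝ}
    {U V : Matrix (Fin (n + 1)) (Fin (n + 1)) ℂ} (hU : Represents n R U)
    (hV : Represents n R V) : ∃ c : ℂ, c * star c = 1 ∧ V = c • U := by
  have hU1 : U * Uᴴ = 1 := Matrix.mem_unitaryGroup_iff.1 hU.1
  have hU2 : Uᴴ * U = 1 := Matrix.mem_unitaryGroup_iff'.1 hU.1
  have hV1 : V * Vᴴ = 1 := Matrix.mem_unitaryGroup_iff.1 hV.1
  have hV2 : Vᴴ * V = 1 := Matrix.mem_unitaryGroup_iff'.1 hV.1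
  -- Both unitaries rotate the angular momentum in the same way, so `Uᴴ V` commutes with every
  -- component and is a scalar.
  have hX := eq_smul_one_of_commute_spinOp (n := n) (X := Uᴴ * V) fun k => by
    have h : V * spinOp n k * Vᴴ = U * spinOp n k * Uᴴ := by rw [hV.2, hU.2]
    have h2 : Uᴴ * (V * spinOp n k * Vᴴ) * V = Uᴴ * (U * spinOp n k * Uᴴ) * V := by rw [h]
    have h3 : Uᴴ * (V * spinOp n k * Vᴴ) * V = Uᴴ * V * spinOp n k * (Vᴴ * V) := by noncomm_ring
    have h4 : Uᴴ * (U * spinOp n k * Uᴴ) * V = (Uᴴ * U) * spinOp n k * (Uᴴ * V) := by noncomm_ring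
    rw [h3, h4, hV2, hU2, Matrix.mul_one, Matrix.one_mul] at h2
    exact h2.symm
  generalize (Uᴴ * V) 0 0 = c at hX
  have hVU : V = c • U := by
    have := congrArg (U * ·) hX
    simpa [← Matrix.mul_assoc, hU1] using this
  refine ⟨c, ?_, hVU⟩
  rw [hVU, Matrix.conjTranspose_smul, Matrix.smul_mul, Matrix.mul_smul, smul_smul, hU1] at hV1
  simpa using congrFun (congrFun hV1 0) 0

theorem represents_rotationUnitary (n : ℕ) (g : SO3) : Represents n g.1 (rotationUnitary n g) :=
  (exists_represents n g).choose_spec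

theorem rotationUnitary_mul_conjTranspose (n : ℕ) (g : SO3) :
    rotationUnitary n g * (rotationUnitary n g)ᴴ = 1 :=
  Matrix.mem_unitaryGroup_iff.1 (represents_rotationUnitary n g).1

theorem rotationUnitary_mul (n : ℕ) (g h : SO3) : ∃ c : ℂ, c * star c = 1 ∧
    rotationUnitary n (g * h) = c • (rotationUnitary n g * rotationUnitary n h) :=
  ((represents_rotationUnitary n g).mul (represents_rotationUnitary n h)).exists_phase
    (represents_rotationUnitary n (g * h))

/-! ### Continuity of the adjoint action -/

/-- The operators on which the adjoint action of the rotation group is continuous. -/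
def continuousConj (n : ℕ) : Subalgebra ℂ (Matrix (Fin (n + 1)) (Fin (n + 1)) ℂ) where
  carrier := {X | Continuous fun g => rotationUnitary n g * X * (rotationUnitary n g)ᴴ}
  mul_mem' {X Y} hX hY := by
    have : (fun g => rotationUnitary n g * (X * Y) * (rotationUnitary n g)ᴴ) = fun g =>
        (rotationUnitary n g * X * (rotationUnitary n g)ᴴ) *
          (rotationUnitary n g * Y * (rotationUnitary n g)ᴴ) := by
      ext1 g
      have h : (rotationUnitary n g)ᴴ * rotationUnitary n g = 1 :=
        mul_eq_one_comm.1 (rotationUnitary_mul_conjTranspose n g)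
      generalize rotationUnitary n g = U at h
      calc U * (X * Y) * Uᴴ = U * X * 1 * Y * Uᴴ := by noncomm_ring
        _ = _ := by rw [← h]; noncomm_ring
    change Continuous _
    rw [this]
    exact Continuous.mul hX hY
  add_mem' {X Y} hX hY := by
    change Continuous _
    simp only [Matrix.mul_add, Matrix.add_mul]
    exact Continuous.add hX hY
  algebraMap_mem' r := by
    change Continuous _
    simp only [Algebra.algebraMap_eq_smul_one, Matrix.mul_smul, Matrix.smul_mul, Matrix.mul_one,
      rotationUnitary_mul_conjTranspose]
    exact continuous_const

theorem spinOp_mem_continuousConj (n : ℕ) (k : Fin 3) : spinOp n k ∈ continuousConj n := by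
  change Continuous _
  simp only [(represents_rotationUnitary n _).2]
  refine continuous_finsetSum _ fun l _ => ?_
  have h : Continuous fun g : SO3 => ((g.1 l k : ℝ) : ℂ) :=
    Complex.continuous_ofReal.comp (continuous_subtype_val.matrix_elem l k)
  exact h.smul continuous_const

theorem mag_injective (n : ℕ) : Function.Injective fun i => (mag n i : ℂ) := by
  intro i j h
  simp only [mag, Complex.ofReal_inj, sub_right_inj, Nat.cast_inj] at h
  exact Fin.ext h

/-- The subalgebra contains the angular momentum, whose adjoint action is given by the entries of
`g`. It is then everything: Lagrange polynomials in `J_z` give the diagonal matrix units, and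
compressing `J₊` and `J₋` between these links neighbouring indices. -/
theorem single_mem_continuousConj (n : ℕ) (i j : Fin (n + 1)) :
    Matrix.single i j (1 : ℂ) ∈ continuousConj n := by
  have hd : ∀ i, Matrix.single i i (1 : ℂ) ∈ continuousConj n := by
    intro i
    have h : Polynomial.aeval (spinOp n 2)
        (Lagrange.basis Finset.univ (fun i => (mag n i : ℂ)) i) = Matrix.single i i (1 : ℂ) := by
      have e : spinOp n 2 = Matrix.diagonalAlgHom ℂ (fun i => (mag n i : ℂ)) := rfl
      rw [e, Polynomial.aeval_algHom_apply, Polynomial.aeval_pi_apply]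
      ext a b
      simp only [Matrix.diagonalAlgHom_apply, Matrix.diagonal_apply, Polynomial.coe_aeval_eq_eval]
      by_cases hab : a = b
      · subst hab
        by_cases hai : i = a
        · subst hai
          rw [Lagrange.eval_basis_self (mag_injective n).injOn (Finset.mem_univ _)]; simp
        · rw [if_pos rfl, Lagrange.eval_basis_of_ne (v := fun i => (mag n i : ℂ)) hai (Finset.mem_univ a)]; simp [hai]
      · rw [if_neg hab, Matrix.single_apply_of_ne]
        rintro ⟨rfl, rfl⟩; exact hab rfl
    rw [← h]
    exact Algebra.adjoin_le (Set.singleton_subset_iff.2 (spinOp_mem_continuousConj n 2))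
      (Polynomial.aeval_mem_adjoin_singleton ℂ _)
  have hp : spinPlus n ∈ continuousConj n := by
    rw [spinPlus_eq]
    exact add_mem (spinOp_mem_continuousConj n 0)
      (Subalgebra.smul_mem _ (spinOp_mem_continuousConj n 1) _)
  have hm : (spinPlus n)ᴴ ∈ continuousConj n := by
    rw [conjTranspose_spinPlus_eq]
    exact sub_mem (spinOp_mem_continuousConj n 0)
      (Subalgebra.smul_mem _ (spinOp_mem_continuousConj n 1) _)
  have key : ∀ X ∈ continuousConj n, ∀ i j, X i j ≠ 0 →
      Matrix.single i j (1 : ℂ) ∈ continuousConj n := by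
    intro X hX i j hij
    have e : Matrix.single i j (1 : ℂ) =
        (X i j)⁻¹ • (Matrix.single i i 1 * X * Matrix.single j j 1) := by
      rw [Matrix.single_mul_mul_single]
      simp [hij]
    rw [e]
    exact Subalgebra.smul_mem _ (mul_mem (mul_mem (hd i) hX) (hd j)) _
  have h0 : ∀ i : Fin (n + 1), Matrix.single 0 i (1 : ℂ) ∈ continuousConj n ∧
      Matrix.single i 0 (1 : ℂ) ∈ continuousConj n := by
    intro i
    induction i using Fin.induction with
    | zero => exact ⟨hd 0, hd 0⟩
    | succ i ih =>
      have h := spinPlus_ne_zero (n := n) (i := i.castSucc) (j := i.succ) (by simp)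
      have h1 := mul_mem ih.1 (key _ hp _ _ h)
      have h2 := mul_mem (key _ hm i.succ i.castSucc (by simpa using h)) ih.2
      rw [Matrix.single_mul_single_same, mul_one] at h1 h2
      exact ⟨h1, h2⟩
  have := mul_mem (h0 i).2 (h0 j).1
  rwa [Matrix.single_mul_single_same, mul_one] at this

theorem isProjectiveRep_rotationUnitary (n : ℕ) : IsProjectiveRep (rotationUnitary n) where
  unitary := rotationUnitary_mul_conjTranspose n
  map_mul := rotationUnitary_mul n
  continuous_entry p q r s := by
    have h : Continuous _ := single_mem_continuousConj n q s
    have h2 := h.matrix_elem p r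
    refine h2.congr fun g => ?_
    rw [IsProjectiveRep.conj_apply, Finset.sum_eq_single q, Finset.sum_eq_single s]
    · simp
    · intro b _ hb; simp [Matrix.single, hb.symm]
    · simp
    · intro b _ hb; simp [Matrix.single, hb.symm]
    · simp

/-! ### The product of the conjugate spin-`1/2` representation with the spin-`J` representation -/

section Pair

variable {a b : Type*}

/-- The operator `V̄ ⊗ U`. -/
def conjKron (V : Matrix a a ℂ) (U : Matrix b b ℂ) : Matrix (a × b) (a × b) ℂ :=
  Matrix.kroneckerMap (· * ·) (V.map star) U

theorem conjKron_apply (V : Matrix a a ℂ) (U : Matrix b b ℂ) (p q : a × b) :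
    conjKron V U p q = star (V p.1 q.1) * U p.2 q.2 := rfl

theorem conjKron_smul_left (c : ℂ) (V : Matrix a a ℂ) (U : Matrix b b ℂ) :
    conjKron (c • V) U = star c • conjKron V U := by
  ext p q
  simp only [conjKron_apply, Matrix.smul_apply, smul_eq_mul, star_mul]
  ring

theorem conjKron_smul_right (c : ℂ) (V : Matrix a a ℂ) (U : Matrix b b ℂ) :
    conjKron V (c • U) = c • conjKron V U := by
  ext p q
  simp only [conjKron_apply, Matrix.smul_apply, smul_eq_mul]
  ring

theorem conjKron_sub_left (V V' : Matrix a a ℂ) (U : Matrix b b ℂ) :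
    conjKron (V - V') U = conjKron V U - conjKron V' U := by
  ext p q
  simp only [conjKron_apply, Matrix.sub_apply, star_sub]
  ring

theorem conjKron_sub_right (V : Matrix a a ℂ) (U U' : Matrix b b ℂ) :
    conjKron V (U - U') = conjKron V U - conjKron V U' := by
  ext p q
  simp only [conjKron_apply, Matrix.sub_apply]
  ring

theorem conjKron_sum_left {ι : Type*} (s : Finset ι) (V : ι → Matrix a a ℂ) (U : Matrix b b ℂ) :
    conjKron (∑ i ∈ s, V i) U = ∑ i ∈ s, conjKron (V i) U := by
  ext p q
  simp only [conjKron_apply, Matrix.sum_apply, star_sum, Finset.sum_mul]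

theorem conjKron_sum_right {ι : Type*} (s : Finset ι) (V : Matrix a a ℂ) (U : ι → Matrix b b ℂ) :
    conjKron V (∑ i ∈ s, U i) = ∑ i ∈ s, conjKron V (U i) := by
  ext p q
  simp only [conjKron_apply, Matrix.sum_apply, Finset.mul_sum]

theorem conjKron_conjTranspose (V : Matrix a a ℂ) (U : Matrix b b ℂ) :
    (conjKron V U)ᴴ = conjKron Vᴴ Uᴴ := by
  ext p q
  simp only [conjKron_apply, Matrix.conjTranspose_apply, star_mul, star_star]
  ring

theorem conjKron_one [DecidableEq a] [DecidableEq b] :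
    conjKron (1 : Matrix a a ℂ) (1 : Matrix b b ℂ) = 1 := by
  rw [conjKron, Matrix.map_one _ (star_zero _) (star_one _)]
  exact Matrix.one_kronecker_one

theorem conjKron_mul [Fintype a] [Fintype b] (V V' : Matrix a a ℂ) (U U' : Matrix b b ℂ) :
    conjKron V U * conjKron V' U' = conjKron (V * V') (U * U') := by
  have e : (V * V').map star = V.map star * V'.map star := by
    ext i j
    simp only [Matrix.map_apply, Matrix.mul_apply, star_sum, star_mul]
    exact Finset.sum_congr rfl fun _ _ => mul_comm _ _
  rw [conjKron, conjKron, conjKron, e]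
  exact (Matrix.mul_kronecker_mul _ _ _ _).symm

/-- The blocks of an operator on a tensor product. -/
def block (Y : Matrix (a × b) (a × b) ℂ) (i j : a) : Matrix b b ℂ :=
  Matrix.of fun k l => Y (i, k) (j, l)

theorem block_mul [Fintype a] [Fintype b] (X Y : Matrix (a × b) (a × b) ℂ) (i j : a) :
    block (X * Y) i j = ∑ k, block X i k * block Y k j := by
  ext p q
  simp only [block, Matrix.of_apply, Matrix.mul_apply, Fintype.sum_prod_type, Matrix.sum_apply]

theorem block_conjKron (V : Matrix a a ℂ) (U : Matrix b b ℂ) (i j : a) :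
    block (conjKron V U) i j = star (V i j) • U := rfl

theorem block_add (X Y : Matrix (a × b) (a × b) ℂ) (i j : a) :
    block (X + Y) i j = block X i j + block Y i j := rfl

theorem block_sub (X Y : Matrix (a × b) (a × b) ℂ) (i j : a) :
    block (X - Y) i j = block X i j - block Y i j := rfl

theorem block_smul (c : ℂ) (Y : Matrix (a × b) (a × b) ℂ) (i j : a) :
    block (c • Y) i j = c • block Y i j := rfl

theorem block_one [DecidableEq a] [DecidableEq b] (i j : a) :
    block (1 : Matrix (a × b) (a × b) ℂ) i j = if i = j then 1 else 0 := by
  ext k l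
  simp only [block, Matrix.of_apply, Matrix.one_apply, Prod.mk.injEq]
  split_ifs with h1 h2 <;> simp_all [Matrix.one_apply]

theorem ext_block {X Y : Matrix (a × b) (a × b) ℂ} (h : ∀ i j, block X i j = block Y i j) :
    X = Y := by
  ext ⟨i, k⟩ ⟨j, l⟩
  exact congrFun (congrFun (h i j) k) l

theorem trace_eq_sum_block [Fintype a] [Fintype b] (Y : Matrix (a × b) (a × b) ℂ) :
    Y.trace = ∑ i, (block Y i i).trace := by
  simp only [Matrix.trace, Matrix.diag_apply, block, Matrix.of_apply, Fintype.sum_prod_type]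

end Pair

/-! ### The infinitesimal action -/

theorem hasDerivAt_clm_exp {𝔸 : Type*} [NormedRing 𝔸] [NormedAlgebra ℂ 𝔸] [CompleteSpace 𝔸]
    (X : 𝔸) (L : 𝔸 →L[ℂ] ℂ) :
    HasDerivAt (fun t : ℝ => L (NormedSpace.exp ((t : ℂ) • X))) (L X) 0 := by
  have h : HasDerivAt (fun t : ℂ => NormedSpace.exp (t • X)) X ((0 : ℝ) : ℂ) := by
    simpa using hasDerivAt_exp_smul_const (𝕂 := ℂ) X (0 : ℂ)
  exact (L.hasFDerivAt.comp_hasDerivAt _ h).comp_ofReal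

attribute [local instance] Matrix.linftyOpNormedRing Matrix.linftyOpNormedAlgebra in
theorem hasDerivAt_exp_apply {m : Type*} [Fintype m] [DecidableEq m] (X : Matrix m m ℂ) (i j : m) :
    HasDerivAt (fun t : ℝ => NormedSpace.exp ((t : ℂ) • X) i j) (X i j) 0 :=
  hasDerivAt_clm_exp X (LinearMap.toContinuousLinearMap (Matrix.entryLinearMap ℂ ℂ i j))

/-- Differentiate the commutation relation at `0`: the generator inherits it. -/
theorem commute_of_hasDerivAt {m : Type*} [Fintype m] {F : ℝ → Matrix m m ℂ}
    {X Y : Matrix m m ℂ} (hF : ∀ i j, HasDerivAt (fun t => F t i j) (X i j) 0)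
    (hY : ∀ t, Commute (F t) Y) : Commute X Y := by
  ext i j
  simp only [Matrix.mul_apply]
  have h1 : HasDerivAt (fun t => ∑ k, F t i k * Y k j) (∑ k, X i k * Y k j) 0 :=
    HasDerivAt.fun_sum fun k _ => (hF i k).mul_const _
  have h2 : HasDerivAt (fun t => ∑ k, Y i k * F t k j) (∑ k, Y i k * X k j) 0 :=
    HasDerivAt.fun_sum fun k _ => (hF k j).const_mul _
  have e : (fun t => ∑ k, F t i k * Y k j) = fun t => ∑ k, Y i k * F t k j := by
    ext t
    simpa only [Matrix.mul_apply] using congrFun (congrFun (hY t).eq i) j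
  rw [e] at h1
  exact h1.unique h2

/-- The components `1 ⊗ J_l - S̄_l ⊗ 1` of the total angular momentum. -/
def totalSpin (n : ℕ) (l : Fin 3) :
    Matrix (Fin (1 + 1) × Fin (n + 1)) (Fin (1 + 1) × Fin (n + 1)) ℂ :=
  conjKron 1 (spinOp n l) - conjKron (spinOp 1 l) 1

/-- The derivative of `V̄ ⊗ U` at `0` is `-i` times the total spin; conjugating `-i S_l` gives `+i
S̄_l`, whence the minus sign in `totalSpin`. -/
theorem commute_totalSpin_of_exp {n : ℕ} {l : Fin 3}
    {Y : Matrix (Fin (1 + 1) × Fin (n + 1)) (Fin (1 + 1) × Fin (n + 1)) ℂ}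
    (h : ∀ t : ℝ, Commute (conjKron (NormedSpace.exp ((t : ℂ) • (-(Complex.I • spinOp 1 l))))
      (NormedSpace.exp ((t : ℂ) • (-(Complex.I • spinOp n l))))) Y) :
    Commute (totalSpin n l) Y := by
  have h1 : Commute (-(Complex.I • totalSpin n l)) Y := by
    refine commute_of_hasDerivAt (fun p q => ?_) h
    simp only [conjKron_apply]
    have hd := ((hasDerivAt_exp_apply (-(Complex.I • spinOp 1 l)) p.1 q.1).star).mul
      (hasDerivAt_exp_apply (-(Complex.I • spinOp n l)) p.2 q.2)
    refine hd.congr_deriv ?_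
    simp only [Complex.ofReal_zero, zero_smul, NormedSpace.exp_zero, totalSpin, Matrix.neg_apply,
      Matrix.smul_apply, Matrix.sub_apply, conjKron_apply, smul_eq_mul, star_neg, star_mul,
      Complex.star_def, Complex.conj_I]
    have : (starRingEnd ℂ) ((1 : Matrix (Fin (1 + 1)) (Fin (1 + 1)) ℂ) p.1 q.1) =
        (1 : Matrix (Fin (1 + 1)) (Fin (1 + 1)) ℂ) p.1 q.1 := by
      rw [Matrix.one_apply]; split_ifs <;> simp
    rw [this]
    ring
  have h2 := h1.smul_left Complex.I
  rwa [smul_neg, smul_smul, Complex.I_mul_I, neg_smul, neg_neg, one_smul] at h2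

/-- Explicit exponentials are at hand only for rotations about `z` and `y`; the `x` component is
reached as a commutator. -/
theorem totalSpin_zero (n : ℕ) : totalSpin n 0 =
    Complex.I • (totalSpin n 2 * totalSpin n 1 - totalSpin n 1 * totalSpin n 2) := by
  have e : totalSpin n 2 * totalSpin n 1 - totalSpin n 1 * totalSpin n 2 =
      conjKron 1 (spinOp n 2 * spinOp n 1 - spinOp n 1 * spinOp n 2) +
        conjKron (spinOp 1 2 * spinOp 1 1 - spinOp 1 1 * spinOp 1 2) 1 := by
    simp only [totalSpin, Matrix.mul_sub, Matrix.sub_mul, conjKron_mul, Matrix.one_mul,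
      Matrix.mul_one, conjKron_sub_left, conjKron_sub_right]
    abel
  rw [e, comm_zy, comm_zy, ← neg_smul, ← neg_smul, conjKron_smul_left, conjKron_smul_right,
    totalSpin, smul_add, smul_smul, smul_smul]
  simp [← sub_eq_add_neg]

/-! ### The commutant -/

theorem spinPlus_one_apply (i j : Fin (1 + 1)) :
    spinPlus 1 i j = if i = 0 ∧ j = 1 then 1 else 0 := by
  fin_cases i <;> fin_cases j <;> (simp [spinPlus, spin, mag]; try norm_num)

theorem mag_one_zero : mag 1 0 = 1 / 2 := by simp [mag, spin]

theorem mag_one_one : mag 1 1 = -1 / 2 := by simp [mag, spin]; norm_num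

/-- The spin-orbit operator `2 ∑ l, S̄_l ⊗ J_l`. -/
def spinOrbit (n : ℕ) : Matrix (Fin (1 + 1) × Fin (n + 1)) (Fin (1 + 1) × Fin (n + 1)) ℂ :=
  (2 : ℂ) • ∑ l, conjKron (spinOp 1 l) (spinOp n l)

/-- Conjugation in the first factor flips the sign of `S_y`, so `J₊` occupies the block where the
usual `S · J` has `J₋`. -/
theorem block_spinOrbit (n : ℕ) : block (spinOrbit n) 0 0 = spinOp n 2 ∧
    block (spinOrbit n) 0 1 = spinPlus n ∧ block (spinOrbit n) 1 0 = (spinPlus n)ᴴ ∧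
    block (spinOrbit n) 1 1 = -spinOp n 2 := by
  have e : ∀ i j, block (spinOrbit n) i j = ((2 : ℂ) * star (spinOp 1 0 i j)) • spinOp n 0 +
      (2 * star (spinOp 1 1 i j)) • spinOp n 1 + (2 * star (spinOp 1 2 i j)) • spinOp n 2 := by
    intro i j
    rw [spinOrbit, block_smul, Fin.sum_univ_three, block_add, block_add, block_conjKron,
      block_conjKron, block_conjKron]
    simp only [smul_add, smul_smul]
  have s0 : ∀ i j, spinOp 1 0 i j = 1 / 2 * (spinPlus 1 i j + star (spinPlus 1 j i)) :=
    fun _ _ => rfl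
  have s1 : ∀ i j, spinOp 1 1 i j = -Complex.I / 2 * (spinPlus 1 i j - star (spinPlus 1 j i)) :=
    fun _ _ => rfl
  refine ⟨?_, ?_, ?_, ?_⟩
  · rw [e]; simp [s0, s1, spinOp_two_apply, spinPlus_one_apply, mag_one_zero]
  · rw [e, spinPlus_eq]; simp [s0, s1, spinOp_two_apply, spinPlus_one_apply]
    ring_nf
  · rw [e, conjTranspose_spinPlus_eq]; simp [s0, s1, spinOp_two_apply, spinPlus_one_apply]
    module
  · rw [e]; simp [s0, s1, spinOp_two_apply, spinPlus_one_apply, mag_one_one]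
    norm_num

theorem trace_spinOrbit (n : ℕ) : (spinOrbit n).trace = 0 := by
  obtain ⟨h00, -, -, h11⟩ := block_spinOrbit n
  rw [trace_eq_sum_block, Fin.sum_univ_two, h00, h11, Matrix.trace_neg, add_neg_cancel]

/-- The combination `J_z² + J₊ J₋ - J_z` commutes with `J_z` and `J₊`, so it is a scalar. Its value
is read off at the lowest weight vector, which `J₋` annihilates. -/
theorem casimir (n : ℕ) : spinOp n 2 * spinOp n 2 + spinPlus n * (spinPlus n)ᴴ =
    ((n / 2 : ℂ) * (n / 2 + 1)) • 1 + spinOp n 2 := by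
  have h1 := comm_zp n
  have h2 := comm_zm n
  have h3 := comm_pm n
  have hlast : (spinPlus n * (spinPlus n)ᴴ) (Fin.last n) (Fin.last n) = 0 := by
    rw [Matrix.mul_apply]
    refine Finset.sum_eq_zero fun k _ => ?_
    rw [spinPlus_eq_zero, zero_mul]
    have := k.2
    simp only [Fin.val_last]
    omega
  set Z := spinOp n 2 with hZ
  set P := spinPlus n
  set Q := Pᴴ
  have hZP : Z * P = P * Z + P := sub_eq_iff_eq_add'.1 h1
  have hZQ : Z * Q = Q * Z - Q := (sub_eq_iff_eq_add'.1 h2).trans (sub_eq_add_neg _ _).symm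
  have hQP : Q * P = P * Q - (2 : ℂ) • Z := by rw [← h3, sub_sub_cancel]
  have c1 : Z * (Z * Z + P * Q - Z) = (Z * Z + P * Q - Z) * Z := by
    have : Z * (P * Q) = P * Q * Z := by
      rw [← Matrix.mul_assoc, hZP, Matrix.add_mul, Matrix.mul_assoc P Z Q, hZQ]
      noncomm_ring
    rw [Matrix.mul_sub, Matrix.mul_add, this]
    noncomm_ring
  have c2 : P * (Z * Z + P * Q - Z) = (Z * Z + P * Q - Z) * P := by
    have e1 : Z * Z * P = P * Z * Z + (2 : ℂ) • (P * Z) + P := by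
      rw [Matrix.mul_assoc, hZP, Matrix.mul_add, ← Matrix.mul_assoc, hZP, two_smul]
      noncomm_ring
    have e2 : P * Q * P = P * (P * Q) - (2 : ℂ) • (P * Z) := by
      rw [Matrix.mul_assoc, hQP, Matrix.mul_sub, Matrix.mul_smul]
    rw [Matrix.sub_mul, Matrix.add_mul, e1, e2, hZP]
    noncomm_ring
  have hs := eq_smul_one_of_commute c1 c2
  generalize (Z * Z + P * Q - Z) 0 0 = c at hs
  have hc := congrFun (congrFun hs (Fin.last n)) (Fin.last n)
  rw [Matrix.sub_apply, Matrix.add_apply, hlast, hZ, spinOp_two_mul_apply, spinOp_two_apply,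
    if_pos rfl, Matrix.smul_apply, Matrix.one_apply_eq, smul_eq_mul, mul_one] at hc
  have hc' : c = (n / 2 : ℂ) * (n / 2 + 1) := by
    rw [← hc]; simp [mag, spin]; ring
  rw [← hc', ← hs]
  abel

/-- Equivalently `(D - (J + 1)) (D + J) = 0` for the spin-orbit operator `D`. The eigenvalue `J + 1`
belongs to total spin `J - 1/2` and `-J` to `J + 1/2`, which explains the constants in `projMinus`.
-/
theorem spinOrbit_mul_self (n : ℕ) : spinOrbit n * spinOrbit n =
    ((n / 2 : ℂ) * (n / 2 + 1)) • 1 + spinOrbit n := by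
  obtain ⟨h00, h01, h10, h11⟩ := block_spinOrbit n
  have hc := casimir n
  refine ext_block fun i j => ?_
  rw [block_mul, Fin.sum_univ_two, block_add, block_smul, block_one]
  fin_cases i <;> fin_cases j <;>
    simp only [Fin.zero_eta, Fin.mk_one, Fin.isValue, h00, h01, h10, h11, zero_ne_one,
      one_ne_zero, if_true, if_false, smul_zero, zero_add]
  · exact hc
  · rw [Matrix.mul_neg, ← sub_eq_add_neg, comm_zp]
  · rw [Matrix.neg_mul, ← sub_eq_add_neg, ← neg_inj, neg_sub, comm_zm]
  · have h3 := comm_pm n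
    have : (spinPlus n)ᴴ * spinPlus n = spinPlus n * (spinPlus n)ᴴ - (2 : ℂ) • spinOp n 2 := by
      rw [← h3]; abel
    rw [this, Matrix.neg_mul, Matrix.mul_neg, neg_neg]
    have : spinPlus n * (spinPlus n)ᴴ =
      ((n / 2 : ℂ) * (n / 2 + 1)) • 1 + spinOp n 2 - spinOp n 2 * spinOp n 2 := by
      rw [← hc]; abel
    rw [this, two_smul]; abel

theorem spinOp_conjTranspose (n : ℕ) (l : Fin 3) : (spinOp n l)ᴴ = spinOp n l := by
  fin_cases l
  · have e0 : spinOp n 0 = (1 / 2 : ℂ) • (spinPlus n + (spinPlus n)ᴴ) := rfl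
    simp [e0, Matrix.conjTranspose_smul, add_comm]
  · exact spinOp_one_herm n
  · exact spinOp_two_herm n

theorem spinOrbit_conjTranspose (n : ℕ) : (spinOrbit n)ᴴ = spinOrbit n := by
  rw [spinOrbit, Matrix.conjTranspose_smul, Matrix.conjTranspose_sum]
  simp [conjKron_conjTranspose, spinOp_conjTranspose]

/-- An operator that commutes with the total angular momentum is a combination of the identity and
the spin-orbit operator. -/
theorem exists_eq_of_commute_totalSpin {n : ℕ}
    {Y : Matrix (Fin (1 + 1) × Fin (n + 1)) (Fin (1 + 1) × Fin (n + 1)) ℂ}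
    (h : ∀ l, Commute (totalSpin n l) Y) : ∃ α β : ℂ, Y = α • 1 + β • spinOrbit n := by
  have bone : ∀ i j (X : Matrix (Fin (n + 1)) (Fin (n + 1)) ℂ),
      block (conjKron (1 : Matrix (Fin (1 + 1)) (Fin (1 + 1)) ℂ) X) i j =
        if i = j then X else 0 := by
    intro i j X
    rw [block_conjKron, Matrix.one_apply]; split_ifs <;> simp
  have bz : ∀ i j, block (totalSpin n 2) i j = (if i = j then spinOp n 2 else 0) -
      (if i = j then ((mag 1 i : ℝ) : ℂ) else 0) • 1 := by
    intro i j
    rw [totalSpin, block_sub, bone, block_conjKron, spinOp_two_apply]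
    split_ifs <;> simp
  have bp : ∀ i j, block (totalSpin n 0 + Complex.I • totalSpin n 1) i j =
      (if i = j then spinPlus n else 0) - (if i = 1 ∧ j = 0 then (1 : ℂ) else 0) • 1 := by
    intro i j
    have e : totalSpin n 0 + Complex.I • totalSpin n 1 =
        conjKron 1 (spinPlus n) - conjKron (spinPlus 1)ᴴ 1 := by
      ext p q
      simp only [totalSpin, spinPlus_eq n, conjTranspose_spinPlus_eq 1, Matrix.add_apply,
        Matrix.sub_apply, Matrix.smul_apply, conjKron_apply, smul_eq_mul, star_sub, star_mul,
        Complex.star_def, Complex.conj_I]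
      ring
    rw [e, block_sub, bone, block_conjKron, Matrix.conjTranspose_apply, star_star,
      spinPlus_one_apply]
    simp only [and_comm]
  have bm : ∀ i j, block (totalSpin n 0 - Complex.I • totalSpin n 1) i j =
      (if i = j then (spinPlus n)ᴴ else 0) - (if i = 0 ∧ j = 1 then (1 : ℂ) else 0) • 1 := by
    intro i j
    have e : totalSpin n 0 - Complex.I • totalSpin n 1 =
        conjKron 1 (spinPlus n)ᴴ - conjKron (spinPlus 1) 1 := by
      ext p q
      simp only [totalSpin, spinPlus_eq 1, conjTranspose_spinPlus_eq n, Matrix.add_apply,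
        Matrix.sub_apply, Matrix.smul_apply, conjKron_apply, smul_eq_mul, star_add, star_mul,
        Complex.star_def, Complex.conj_I]
      ring
    rw [e, block_sub, bone, block_conjKron, spinPlus_one_apply]
    split_ifs <;> simp
  have hz := fun i j => congrArg (fun X => block X i j) (h 2).eq
  have hp := fun i j => congrArg (fun X => block X i j)
    ((h 0).add_left ((h 1).smul_left Complex.I)).eq
  have hm := fun i j => congrArg (fun X => block X i j)
    ((h 0).sub_left ((h 1).smul_left Complex.I)).eq
  simp only [block_mul, bz, bp, bm] at hz hp hm
  set a := block Y 0 0 with ha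
  set b := block Y 0 1 with hb
  set c := block Y 1 0 with hc
  set d := block Y 1 1 with hd
  set Z := spinOp n 2
  set P := spinPlus n
  have z00 := hz 0 0
  have z01 := hz 0 1
  have z11 := hz 1 1
  have p00 := hp 0 0
  have p01 := hp 0 1
  have p11 := hp 1 1
  have m00 := hm 0 0
  have m01 := hm 0 1
  simp [← ha, ← hb, ← hc, ← hd, mag_one_zero, mag_one_one, Matrix.sub_mul, Matrix.mul_sub,
    -Complex.coe_smul]
    at z00 z01 z11 p00 p01 p11 m00 m01
  have Zad : Z * (a + d) = (a + d) * Z := by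
    rw [Matrix.mul_add, Matrix.add_mul, z00, z11]
  have Pad : P * (a + d) = (a + d) * P := by
    rw [Matrix.mul_add, Matrix.add_mul, p00, ← p11]; abel
  have Zb : Z * b - b * Z = b := by
    have : Z * b = b * Z - (-1 / 2 : ℂ) • b + (2⁻¹ : ℂ) • b := by rw [← z01]; abel
    rw [this]; module
  -- The upper right block behaves like `J₊`, hence is `β J₊`, and `a + d` is a scalar by
  -- irreducibility. Commutators with `J₋` then give `d - a` from `b`, and `c` from `a`, so the two
  -- scalars determine `Y`.
  obtain ⟨β, hβ⟩ := exists_eq_smul_spinPlus Zb p01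
  have hs := eq_smul_one_of_commute Zad Pad
  generalize (a + d) 0 0 = α at hs
  have hda : d - a = (-(2 * β)) • Z := by
    have e1 : d - a = Pᴴ * b - b * Pᴴ := by
      have : Pᴴ * b = b * Pᴴ - a + d := by rw [← m01]; abel
      rw [this]; abel
    rw [e1, hβ, Matrix.mul_smul, Matrix.smul_mul, ← smul_sub, ← neg_sub (P * Pᴴ), comm_pm]
    module
  have ha' : a = (α / 2) • 1 + β • Z := by
    have : a = (1 / 2 : ℂ) • ((a + d) - (d - a)) := by module
    rw [this, hs, hda]; module
  have hd' : d = (α / 2) • 1 + (-β) • Z := by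
    have : d = (1 / 2 : ℂ) • ((a + d) + (d - a)) := by module
    rw [this, hs, hda]; module
  have hc' : c = β • Pᴴ := by
    have e1 : c = Pᴴ * a - a * Pᴴ := by rw [← m00]; abel
    have e2 := comm_zm n
    rw [e1, ha', Matrix.mul_add, Matrix.add_mul, Matrix.mul_smul, Matrix.smul_mul,
      Matrix.mul_smul, Matrix.smul_mul, Matrix.mul_one, Matrix.one_mul, add_sub_add_left_eq_sub,
      ← smul_sub, ← neg_sub, e2, neg_neg]
  obtain ⟨h00, h01, h10, h11⟩ := block_spinOrbit n
  refine ⟨α / 2, β, ext_block fun i j => ?_⟩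
  rw [block_add, block_smul, block_smul, block_one]
  fin_cases i <;> fin_cases j
  · simpa [h00] using ha'
  · simpa [h01] using hβ
  · simpa [h10] using hc'
  · simpa [h11] using hd'

/-! ### The average over the product representation -/

/-- The product representation `Ū_{g,1/2} ⊗ U_{g,J}`. -/
def pairUnitary (n : ℕ) (g : SO3) :
    Matrix (Fin (1 + 1) × Fin (n + 1)) (Fin (1 + 1) × Fin (n + 1)) ℂ :=
  conjKron (rotationUnitary 1 g) (rotationUnitary n g)

theorem isProjectiveRep_pairUnitary (n : ℕ) : IsProjectiveRep (pairUnitary n) where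
  unitary g := by
    rw [pairUnitary, conjKron_conjTranspose, conjKron_mul, rotationUnitary_mul_conjTranspose,
      rotationUnitary_mul_conjTranspose, conjKron_one]
  map_mul g h := by
    obtain ⟨c, hc, e⟩ := rotationUnitary_mul 1 g h
    obtain ⟨d, hd, e'⟩ := rotationUnitary_mul n g h
    refine ⟨star c * d, ?_, ?_⟩
    · rw [star_mul, star_star]
      linear_combination (d * star d) * hc + hd
    · rw [pairUnitary, pairUnitary, pairUnitary, e, e', conjKron_smul_left, conjKron_smul_right,
        conjKron_mul, smul_smul]
  continuous_entry p q r s := by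
    have h1 := (isProjectiveRep_rotationUnitary 1).continuous_entry r.1 s.1 p.1 q.1
    have h2 := (isProjectiveRep_rotationUnitary n).continuous_entry p.2 q.2 r.2 s.2
    refine (h1.mul h2).congr fun g => ?_
    simp only [pairUnitary, conjKron_apply, star_mul, star_star, Pi.mul_apply]
    ring

/-- The spin-orbit operator is a scalar product of two vectors rotated by the same orthogonal
matrix. The matrix is real, so the conjugation does no harm. -/
theorem commute_spinOrbit (n : ℕ) (g : SO3) : Commute (pairUnitary n g) (spinOrbit n) := by
  have h1 := represents_rotationUnitary 1 g
  have h2 := represents_rotationUnitary n g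
  have hR : g.1 * g.1ᵀ = 1 := (Matrix.mem_orthogonalGroup_iff (Fin 3) ℝ).1
      (Matrix.mem_specialOrthogonalGroup_iff.1 g.2).1
  have hR' : ∀ k m, ∑ l, (g.1 k l : ℂ) * (g.1 m l : ℂ) = if k = m then 1 else 0 := by
    intro k m
    have := congrFun (congrFun hR k) m
    rw [Matrix.mul_apply, Matrix.one_apply] at this
    simp only [Matrix.transpose_apply] at this
    rw [← Complex.ofReal_one, ← Complex.ofReal_zero, ← apply_ite Complex.ofReal, ← this]
    push_cast; rfl
  have key : pairUnitary n g * spinOrbit n * (pairUnitary n g)ᴴ = spinOrbit n := by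
    rw [spinOrbit, pairUnitary, Matrix.mul_smul, Matrix.smul_mul, Finset.mul_sum, Finset.sum_mul,
      conjKron_conjTranspose]
    simp only [conjKron_mul, h1.2, h2.2, conjKron_sum_left, conjKron_sum_right,
      conjKron_smul_left, conjKron_smul_right, Complex.star_def, Complex.conj_ofReal]
    congr 1
    simp only [Finset.smul_sum, smul_smul]
    rw [Finset.sum_comm]
    refine Finset.sum_congr rfl fun k _ => ?_
    rw [Finset.sum_comm]
    simp only [← Finset.sum_smul, hR']
    simp
  have h := congrArg (· * pairUnitary n g) key
  simp only [Matrix.mul_assoc, (isProjectiveRep_pairUnitary n).unitary', Matrix.mul_one] at h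
  exact h

/-- Replaces the chosen unitaries, of unknown phase, by the explicit exponentials, which can be
differentiated. -/
theorem Represents.commute_of_forall {n : ℕ} {R : Matrix (Fin 3) (Fin 3) ℝ}
    (hR : R ∈ Matrix.specialOrthogonalGroup (Fin 3) ℝ)
    {V : Matrix (Fin (1 + 1)) (Fin (1 + 1)) ℂ} {U : Matrix (Fin (n + 1)) (Fin (n + 1)) ℂ}
    (hV : Represents 1 R V) (hU : Represents n R U)
    {Y : Matrix (Fin (1 + 1) × Fin (n + 1)) (Fin (1 + 1) × Fin (n + 1)) ℂ}
    (hY : ∀ g, Commute (pairUnitary n g) Y) : Commute (conjKron V U) Y := by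
  obtain ⟨c, -, e⟩ := (represents_rotationUnitary 1 ⟨R, hR⟩).exists_phase hV
  obtain ⟨d, -, e'⟩ := (represents_rotationUnitary n ⟨R, hR⟩).exists_phase hU
  rw [e, e', conjKron_smul_left, conjKron_smul_right]
  exact ((hY ⟨R, hR⟩).smul_left _).smul_left _

theorem rotZ_mem (t : ℝ) : rotZ t ∈ Matrix.specialOrthogonalGroup (Fin 3) ℝ := by
  have hs := Real.sin_sq_add_cos_sq t
  rw [Matrix.mem_specialOrthogonalGroup_iff, Matrix.mem_orthogonalGroup_iff]
  constructor
  · ext i j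
    fin_cases i <;> fin_cases j <;> simp [rotZ, Matrix.mul_apply, Fin.sum_univ_three] <;>
      linarith
  · rw [Matrix.det_fin_three]; simp [rotZ]; linarith

theorem rotY_mem (t : ℝ) : rotY t ∈ Matrix.specialOrthogonalGroup (Fin 3) ℝ := by
  have hs := Real.sin_sq_add_cos_sq t
  rw [Matrix.mem_specialOrthogonalGroup_iff, Matrix.mem_orthogonalGroup_iff]
  constructor
  · ext i j
    fin_cases i <;> fin_cases j <;> simp [rotY, Matrix.mul_apply, Fin.sum_univ_three] <;>
      linarith
  · rw [Matrix.det_fin_three]; simp [rotY]; linarith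

theorem exists_eq_of_commute_pairUnitary {n : ℕ}
    {Y : Matrix (Fin (1 + 1) × Fin (n + 1)) (Fin (1 + 1) × Fin (n + 1)) ℂ}
    (h : ∀ g, Commute (pairUnitary n g) Y) : ∃ α β : ℂ, Y = α • 1 + β • spinOrbit n := by
  have h2 : Commute (totalSpin n 2) Y := commute_totalSpin_of_exp fun t =>
    Represents.commute_of_forall (rotZ_mem t) (represents_rotZ 1 t) (represents_rotZ n t) h
  have h1 : Commute (totalSpin n 1) Y := commute_totalSpin_of_exp fun t =>
    Represents.commute_of_forall (rotY_mem t) (represents_rotY 1 t) (represents_rotY n t) h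
  have h0 : Commute (totalSpin n 0) Y := by
    rw [totalSpin_zero]
    exact ((h2.mul_left h1).sub_left (h1.mul_left h2)).smul_left _
  refine exists_eq_of_commute_totalSpin fun l => ?_
  fin_cases l
  exacts [h0, h1, h2]

/-- The projection onto the spin-`(J - 1/2)` component. -/
def projMinus (n : ℕ) : Matrix (Fin (1 + 1) × Fin (n + 1)) (Fin (1 + 1) × Fin (n + 1)) ℂ :=
  ((n : ℂ) + 1)⁻¹ • (spinOrbit n + (n / 2 : ℂ) • 1)

/-- The projection onto the spin-`(J + 1/2)` component. -/
def projPlus (n : ℕ) : Matrix (Fin (1 + 1) × Fin (n + 1)) (Fin (1 + 1) × Fin (n + 1)) ℂ :=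
  1 - projMinus n

theorem projMinus_conjTranspose (n : ℕ) : (projMinus n)ᴴ = projMinus n := by
  simp [projMinus, Matrix.conjTranspose_smul, spinOrbit_conjTranspose]

theorem projMinus_mul_self (n : ℕ) : projMinus n * projMinus n = projMinus n := by
  have hn : ((n : ℂ) + 1) ≠ 0 := Nat.cast_add_one_ne_zero n
  rw [projMinus, Matrix.smul_mul, Matrix.mul_smul]
  congr 1
  rw [Matrix.mul_add, Matrix.add_mul, Matrix.add_mul, spinOrbit_mul_self, Matrix.mul_smul,
    Matrix.mul_smul, Matrix.smul_mul, Matrix.mul_one, Matrix.mul_one, Matrix.one_mul]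
  match_scalars <;> field_simp <;> ring

/-- The dimension `2J` of the spin-`(J - 1/2)` component; it is the `n` in the denominator of the
final bound. -/
theorem trace_projMinus (n : ℕ) : (projMinus n).trace = n := by
  have hn : ((n : ℂ) + 1) ≠ 0 := Nat.cast_add_one_ne_zero n
  rw [projMinus, Matrix.trace_smul, Matrix.trace_add, trace_spinOrbit, Matrix.trace_smul,
    Matrix.trace_one]
  simp
  field_simp

theorem trace_projPlus (n : ℕ) : (projPlus n).trace = n + 2 := by
  rw [projPlus, Matrix.trace_sub, trace_projMinus, Matrix.trace_one]
  simp
  ring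

theorem projPlus_mul_projMinus (n : ℕ) : projPlus n * projMinus n = 0 := by
  rw [projPlus, Matrix.sub_mul, projMinus_mul_self, Matrix.one_mul, sub_self]

theorem projMinus_mul_projPlus (n : ℕ) : projMinus n * projPlus n = 0 := by
  rw [projPlus, Matrix.mul_sub, projMinus_mul_self, Matrix.mul_one, sub_self]

theorem projPlus_mul_self (n : ℕ) : projPlus n * projPlus n = projPlus n := by
  conv_lhs => rw [projPlus, Matrix.sub_mul, ← projPlus, projMinus_mul_projPlus, Matrix.one_mul,
    sub_zero]

theorem projPlus_conjTranspose (n : ℕ) : (projPlus n)ᴴ = projPlus n := by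
  simp [projPlus, projMinus_conjTranspose]

theorem commute_projMinus (n : ℕ) (g : SO3) : Commute (pairUnitary n g) (projMinus n) :=
  ((commute_spinOrbit n g).add_right ((Commute.one_right _).smul_right _)).smul_right _

theorem commute_projPlus (n : ℕ) (g : SO3) : Commute (pairUnitary n g) (projPlus n) :=
  (Commute.one_right _).sub_right (commute_projMinus n g)

open IsProjectiveRep in
/-- Schur's lemma: the average over the product representation. -/
theorem twirl_pairUnitary {n : ℕ} (hn : n ≠ 0)
    (Y : Matrix (Fin (1 + 1) × Fin (n + 1)) (Fin (1 + 1) × Fin (n + 1)) ℂ) :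
    twirl (pairUnitary n) Y = ((projMinus n * Y).trace / n) • projMinus n +
      ((projPlus n * Y).trace / (n + 2)) • projPlus n := by
  have hW := isProjectiveRep_pairUnitary n
  have hn0 : (n : ℂ) ≠ 0 := Nat.cast_ne_zero.2 hn
  have hn1 : ((n : ℂ) + 1) ≠ 0 := Nat.cast_add_one_ne_zero n
  have hn2 : ((n : ℂ) + 2) ≠ 0 := by exact_mod_cast (show n + 2 ≠ 0 by omega)
  obtain ⟨x, y, h⟩ : ∃ x y : ℂ, twirl (pairUnitary n) Y = x • projMinus n + y • projPlus n := by
    obtain ⟨α, β, h⟩ := exists_eq_of_commute_pairUnitary (n := n) (Y := twirl (pairUnitary n) Y)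
      fun g => hW.commute_twirl g Y
    have hD : spinOrbit n = ((n : ℂ) + 1) • projMinus n - (n / 2 : ℂ) • 1 := by
      rw [projMinus, smul_smul, mul_inv_cancel₀ hn1]; module
    -- The values of `α + β D` at the eigenvalues `J + 1` and `-J` of the spin-orbit operator `D`.
    refine ⟨α + β * (n / 2 + 1), α - β * (n / 2), ?_⟩
    rw [h, hD, projPlus]
    module
  have h1 := hW.trace_mul_twirl (commute_projMinus n) Y
  have h2 := hW.trace_mul_twirl (commute_projPlus n) Y
  rw [h, Matrix.mul_add, Matrix.mul_smul, Matrix.mul_smul, projMinus_mul_self,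
    projMinus_mul_projPlus, smul_zero, add_zero, Matrix.trace_smul, trace_projMinus] at h1
  rw [h, Matrix.mul_add, Matrix.mul_smul, Matrix.mul_smul, projPlus_mul_self,
    projPlus_mul_projMinus, smul_zero, zero_add, Matrix.trace_smul, trace_projPlus] at h2
  rw [h, ← h1, ← h2, smul_eq_mul, smul_eq_mul, mul_div_cancel_right₀ _ hn0,
    mul_div_cancel_right₀ _ hn2]

-- Schur's lemma for one spin: the twirl commutes with `J_z` and `J_y` by differentiation, with
-- `J_x` as their commutator, so it is a scalar, fixed by its trace.
open IsProjectiveRep in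
theorem twirl_rotationUnitary (n : ℕ) (Y : Matrix (Fin (n + 1)) (Fin (n + 1)) ℂ) :
    twirl (rotationUnitary n) Y = (Y.trace / (n + 1)) • 1 := by
  have hW := isProjectiveRep_rotationUnitary n
  have hn1 : ((n : ℂ) + 1) ≠ 0 := Nat.cast_add_one_ne_zero n
  have key : ∀ t (l : Fin 3) (R : Matrix (Fin 3) (Fin 3) ℝ),
      R ∈ Matrix.specialOrthogonalGroup (Fin 3) ℝ →
      Represents n R (NormedSpace.exp (((t : ℝ) : ℂ) • (-(Complex.I • spinOp n l)))) →
      Commute (NormedSpace.exp ((t : ℂ) • (-(Complex.I • spinOp n l))))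
        (twirl (rotationUnitary n) Y) := by
    intro t l R hR h
    obtain ⟨c, -, e⟩ := (represents_rotationUnitary n ⟨R, hR⟩).exists_phase h
    rw [e]
    exact (hW.commute_twirl ⟨R, hR⟩ Y).smul_left _
  have hI : ∀ X Z : Matrix (Fin (n + 1)) (Fin (n + 1)) ℂ,
      Commute (-(Complex.I • X)) Z → Commute X Z := by
    intro X Z h
    have h2 := h.smul_left Complex.I
    rwa [smul_neg, smul_smul, Complex.I_mul_I, neg_smul, neg_neg, one_smul] at h2
  have h2 : Commute (spinOp n 2) (twirl (rotationUnitary n) Y) :=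
    hI _ _ (commute_of_hasDerivAt (fun i j => hasDerivAt_exp_apply _ i j)
      fun t => key t 2 _ (rotZ_mem t) (represents_rotZ n t))
  have h1 : Commute (spinOp n 1) (twirl (rotationUnitary n) Y) :=
    hI _ _ (commute_of_hasDerivAt (fun i j => hasDerivAt_exp_apply _ i j)
      fun t => key t 1 _ (rotY_mem t) (represents_rotY n t))
  have h0 : Commute (spinOp n 0) (twirl (rotationUnitary n) Y) := by
    have e : spinOp n 0 =
        Complex.I • (spinOp n 2 * spinOp n 1 - spinOp n 1 * spinOp n 2) := by
      rw [comm_zy, smul_neg, smul_smul, Complex.I_mul_I, neg_smul, one_smul, neg_neg]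
    rw [e]
    exact ((h2.mul_left h1).sub_left (h1.mul_left h2)).smul_left _
  have hs := eq_smul_one_of_commute_spinOp (n := n) (X := twirl (rotationUnitary n) Y) fun l => by
    fin_cases l
    exacts [h0, h1, h2]
  generalize twirl (rotationUnitary n) Y 0 0 = c at hs
  have ht := hW.trace_twirl Y
  rw [hs, Matrix.trace_smul, Matrix.trace_one, Fintype.card_fin] at ht
  rw [hs, ← ht]
  push_cast
  rw [smul_eq_mul, mul_div_cancel_right₀ _ hn1]

/-! ### Mean squares of matrix coefficients. -/

theorem trace_mul_single_one {m : Type*} [Fintype m] [DecidableEq m] (P : Matrix m m ℂ) (q s : m) :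
    (P * Matrix.single q s 1).trace = P s q := by
  rw [Matrix.trace_mul_comm, Matrix.trace, Finset.sum_eq_single q]
  · simp
  · intro b _ hb; simp [hb]
  · simp

theorem sum_mul_star_mul {m : Type*} [Fintype m] (B P Q : Matrix m m ℂ) :
    ∑ q, ∑ p, ∑ s, ∑ r, B q p * star (B s r) * (P s q * Q p r) =
      (P * B * Q * Bᴴ).trace := by
  have e : (P * B * Q * Bᴴ).trace =
      ∑ s, ∑ r, ∑ p, ∑ q, B q p * star (B s r) * (P s q * Q p r) := by
    simp only [Matrix.trace, Matrix.diag_apply, Matrix.mul_apply, Matrix.conjTranspose_apply, Finset.sum_mul]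
    exact Finset.sum_congr rfl fun _ _ => Finset.sum_congr rfl fun _ _ =>
      Finset.sum_congr rfl fun _ _ => Finset.sum_congr rfl fun _ _ => by ring
  rw [e, sum_comm₄]
  exact Finset.sum_congr rfl fun _ _ => Finset.sum_congr rfl fun _ _ => Finset.sum_comm

/-- The average of the squared matrix coefficients of the spin representation. -/
theorem integral_rotationUnitary (n : ℕ) (B : Matrix (Fin (n + 1)) (Fin (n + 1)) ℂ) :
    ∫ g, (B * rotationUnitary n g).trace * star (B * rotationUnitary n g).trace ∂haarSO3 =
      (B * Bᴴ).trace / (n + 1) := by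
  rw [(isProjectiveRep_rotationUnitary n).integral_trace_mul_star]
  have h := sum_mul_star_mul B 1 1
  rw [Matrix.one_mul, Matrix.mul_one] at h
  rw [← h, Finset.sum_div]
  refine Finset.sum_congr rfl fun q _ => ?_
  simp only [Finset.sum_div]
  refine Finset.sum_congr rfl fun p _ => Finset.sum_congr rfl fun s _ =>
    Finset.sum_congr rfl fun r _ => ?_
  have ht := trace_mul_single_one (1 : Matrix (Fin (n + 1)) (Fin (n + 1)) ℂ) q s
  rw [Matrix.one_mul] at ht
  rw [twirl_rotationUnitary, ht, Matrix.smul_apply, smul_eq_mul]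
  ring

/-- The trace is the squared Hilbert-Schmidt norm of the block `P B Q`. -/
theorem trace_proj_nonneg {m : Type*} [Fintype m] {P Q : Matrix m m ℂ} (hP : P * P = P)
    (hP' : Pᴴ = P) (hQ : Q * Q = Q) (hQ' : Qᴴ = Q) (B : Matrix m m ℂ) :
    0 ≤ (P * B * Q * Bᴴ).trace := by
  have e : (P * B * Q * Bᴴ).trace = ((P * B * Q) * (P * B * Q)ᴴ).trace := by
    rw [Matrix.conjTranspose_mul, Matrix.conjTranspose_mul, hP', hQ']
    have : P * B * Q * (Q * (Bᴴ * P)) = P * B * (Q * Q) * Bᴴ * P := by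
      simp only [Matrix.mul_assoc]
    rw [this, hQ, Matrix.trace_mul_comm _ P, ← Matrix.mul_assoc, ← Matrix.mul_assoc,
      ← Matrix.mul_assoc, hP]
  rw [e]
  exact (Matrix.posSemidef_self_mul_conjTranspose _).trace_nonneg

/-- Only the two diagonal blocks of `B` contribute, with weights `1/n` and `1/(n + 2)`. Raising the
second weight to `1/n` and adding the nonnegative off-diagonal blocks restores the full norm of `B`.
-/
theorem integral_pairUnitary_le {n : ℕ} (hn : n ≠ 0)
    (B : Matrix (Fin (1 + 1) × Fin (n + 1)) (Fin (1 + 1) × Fin (n + 1)) ℂ) :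
    ∫ g, (B * pairUnitary n g).trace * star (B * pairUnitary n g).trace ∂haarSO3 ≤
      (B * Bᴴ).trace / n := by
  have hn0 : (0 : ℂ) < n := by exact_mod_cast Nat.pos_of_ne_zero hn
  have hn2 : (n : ℂ) ≤ n + 2 := by simp
  have e : ∫ g, (B * pairUnitary n g).trace * star (B * pairUnitary n g).trace ∂haarSO3 =
      (projMinus n * B * projMinus n * Bᴴ).trace / n +
        (projPlus n * B * projPlus n * Bᴴ).trace / (n + 2) := by
    rw [(isProjectiveRep_pairUnitary n).integral_trace_mul_star]
    simp only [twirl_pairUnitary hn, trace_mul_single_one]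
    rw [← sum_mul_star_mul, ← sum_mul_star_mul]
    simp only [Finset.sum_div, ← Finset.sum_add_distrib]
    refine Finset.sum_congr rfl fun q _ => Finset.sum_congr rfl fun p _ =>
      Finset.sum_congr rfl fun s _ => Finset.sum_congr rfl fun r _ => ?_
    rw [Matrix.add_apply, Matrix.smul_apply, Matrix.smul_apply, smul_eq_mul, smul_eq_mul]
    ring
  have hsum : (B * Bᴴ).trace = (projMinus n * B * projMinus n * Bᴴ).trace +
      (projMinus n * B * projPlus n * Bᴴ).trace + (projPlus n * B * projMinus n * Bᴴ).trace +
      (projPlus n * B * projPlus n * Bᴴ).trace := by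
    rw [← Matrix.trace_add, ← Matrix.trace_add, ← Matrix.trace_add]
    congr 1
    simp only [projPlus]
    noncomm_ring
  have p1 := trace_proj_nonneg (projMinus_mul_self n) (projMinus_conjTranspose n)
    (projPlus_mul_self n) (projPlus_conjTranspose n) B
  have p2 := trace_proj_nonneg (projPlus_mul_self n) (projPlus_conjTranspose n)
    (projMinus_mul_self n) (projMinus_conjTranspose n) B
  have p3 := trace_proj_nonneg (projPlus_mul_self n) (projPlus_conjTranspose n)
    (projPlus_mul_self n) (projPlus_conjTranspose n) B
  have q1 := div_nonneg p1 hn0.le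
  have q2 := div_nonneg p2 hn0.le
  have q3 := div_le_div_of_nonneg_left p3 hn0 hn2
  rw [e, hsum, add_div, add_div, add_div]
  refine (add_le_add_right q3 _).trans ?_
  rw [add_le_add_iff_right, add_assoc]
  exact le_add_of_nonneg_right (add_nonneg q1 q2)

/-! ### Fidelities of machines -/

/-- The rotated Bell state is the unitary itself, read as a vector; overlaps with it are therefore
matrix coefficients. -/
theorem rotatedBell_apply (n : ℕ) (g : SO3) (p : Fin (n + 1) × Fin (n + 1)) :
    rotatedBell n g p = (((√(n + 1 : ℝ))⁻¹ : ℝ) : ℂ) * rotationUnitary n g p.1 p.2 := by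
  have e : 2 * spin n + 1 = n + 1 := by simp only [spin]; ring
  rw [rotatedBell, Matrix.mulVec, dotProduct, Fintype.sum_prod_type]
  simp only [Matrix.kroneckerMap_apply, bell, e, Matrix.one_apply, mul_ite, ite_mul, mul_one,
    mul_zero, zero_mul]
  simp [mul_comm]

theorem normSq_inv_sqrt (n : ℕ) :
    Complex.normSq (((√(n + 1 : ℝ))⁻¹ : ℝ) : ℂ) = 1 / (n + 1) := by
  rw [Complex.normSq_ofReal, ← mul_inv, Real.mul_self_sqrt (by positivity), one_div]

theorem ofReal_normSq (z : ℂ) : ((Complex.normSq z : ℝ) : ℂ) = z * star z :=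
  (Complex.mul_conj z).symm

theorem trace_mul_conjTranspose_eq {m : Type*} [Fintype m] (B : Matrix m m ℂ) :
    (B * Bᴴ).trace = ((∑ i, ∑ j, Complex.normSq (B i j) : ℝ) : ℂ) := by
  push_cast
  simp only [ofReal_normSq]
  rfl

theorem sum_normSq_rotatedBell (n : ℕ) (g : SO3) :
    ∑ p, Complex.normSq (rotatedBell n g p) = 1 := by
  have h := trace_mul_conjTranspose_eq (rotationUnitary n g)
  rw [rotationUnitary_mul_conjTranspose, Matrix.trace_one, Fintype.card_fin] at h
  have h' : (∑ i, ∑ j, Complex.normSq (rotationUnitary n g i j)) = (n : ℝ) + 1 := by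
    exact_mod_cast h.symm
  simp only [rotatedBell_apply, Complex.normSq_mul, normSq_inv_sqrt, Fintype.sum_prod_type,
    ← Finset.mul_sum]
  rw [h']
  field_simp

theorem IsProjectiveRep.continuous_normSq_trace {m : Type*} [Fintype m] [DecidableEq m]
    {W : SO3 → Matrix m m ℂ} (hW : IsProjectiveRep W) (B : Matrix m m ℂ) :
    Continuous fun g => Complex.normSq (B * W g).trace := by
  have h : Continuous fun g => ((Complex.normSq (B * W g).trace : ℝ) : ℂ) := by
    have e : ∀ g, ((Complex.normSq (B * W g).trace : ℝ) : ℂ) =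
        ∑ q, ∑ p, ∑ s, ∑ r, B q p * star (B s r) * (W g p q * star (W g r s)) := by
      intro g
      rw [ofReal_normSq]
      simp only [Matrix.trace, Matrix.diag_apply, Matrix.mul_apply, star_sum, star_mul,
        Finset.sum_mul]
      refine Finset.sum_congr rfl fun q _ => Finset.sum_congr rfl fun p _ => ?_
      simp only [Finset.mul_sum]
      exact Finset.sum_congr rfl fun _ _ => Finset.sum_congr rfl fun _ _ => by ring
    simp only [e]
    exact continuous_finsetSum _ fun q _ => continuous_finsetSum _ fun p _ =>
      continuous_finsetSum _ fun s _ => continuous_finsetSum _ fun r _ =>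
        continuous_const.mul (hW.continuous_entry p q r s)
  exact Complex.continuous_re.comp h

theorem integral_normSq_rotationUnitary (n : ℕ) (B : Matrix (Fin (n + 1)) (Fin (n + 1)) ℂ) :
    ∫ g, Complex.normSq (B * rotationUnitary n g).trace ∂haarSO3 =
      (∑ i, ∑ j, Complex.normSq (B i j)) / (n + 1) := by
  have h := integral_rotationUnitary n B
  simp only [← ofReal_normSq, trace_mul_conjTranspose_eq] at h
  rw [integral_complex_ofReal] at h
  exact_mod_cast h

theorem integral_normSq_pairUnitary_le {n : ℕ} (hn : n ≠ 0)
    (B : Matrix (Fin (1 + 1) × Fin (n + 1)) (Fin (1 + 1) × Fin (n + 1)) ℂ) :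
    ∫ g, Complex.normSq (B * pairUnitary n g).trace ∂haarSO3 ≤
      (∑ i, ∑ j, Complex.normSq (B i j)) / n := by
  have h := integral_pairUnitary_le hn B
  simp only [← ofReal_normSq, trace_mul_conjTranspose_eq] at h
  rw [integral_complex_ofReal] at h
  exact_mod_cast h

/-- The overlap of a vector with a Bell state, as a matrix coefficient. -/
theorem normSq_dotProduct_rotatedBell (n : ℕ) (g : SO3)
    (v : Fin (n + 1) × Fin (n + 1) → ℂ) :
    Complex.normSq (v ⬝ᵥ rotatedBell n g) =
      1 / (n + 1) * Complex.normSq ((Matrix.of fun b a => v (a, b)) * rotationUnitary n g).trace := by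
  have e : v ⬝ᵥ rotatedBell n g = (((√(n + 1 : ℝ))⁻¹ : ℝ) : ℂ) *
      ((Matrix.of fun b a => v (a, b)) * rotationUnitary n g).trace := by
    simp only [dotProduct, rotatedBell_apply, Matrix.trace, Matrix.diag_apply, Matrix.mul_apply,
      Matrix.of_apply, Fintype.sum_prod_type, Finset.mul_sum]
    rw [Finset.sum_comm]
    exact Finset.sum_congr rfl fun _ _ => Finset.sum_congr rfl fun _ _ => by ring
  rw [e, Complex.normSq_mul, normSq_inv_sqrt]

/-- Regroup the tensor factors, from `(a ⊗ b, c ⊗ d)` to `(b ⊗ d, a ⊗ c)`. -/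
def realign {a b c d : Type*} (L : Matrix (a × b) (c × d) ℂ) : Matrix (b × d) (a × c) ℂ :=
  Matrix.of fun p q => L (q.1, p.1) (q.2, p.2)

theorem sum_comm₄' {α β γ δ R : Type*} [Fintype α] [Fintype β] [Fintype γ] [Fintype δ]
    [AddCommMonoid R] (f : α → β → γ → δ → R) :
    ∑ a, ∑ b, ∑ c, ∑ d, f a b c d = ∑ b, ∑ d, ∑ a, ∑ c, f a b c d := by
  simp only [← Fintype.sum_prod_type']
  exact Fintype.sum_equiv ⟨fun p => (p.2.1, p.2.2.2, p.1, p.2.2.1),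
    fun p => (p.2.2.1, p.1, p.2.2.2, p.2.1), fun _ => rfl, fun _ => rfl⟩ _ _ fun _ => rfl

/-- Realignment only permutes entries, so the Hilbert-Schmidt norm, the common measure of both
averages, survives it. -/
theorem sum_normSq_realign {a b c d : Type*} [Fintype a] [Fintype b] [Fintype c] [Fintype d]
    (L : Matrix (a × b) (c × d) ℂ) :
    ∑ i, ∑ j, Complex.normSq (realign L i j) = ∑ x, ∑ p, Complex.normSq (L x p) := by
  simp only [Fintype.sum_prod_type, realign, Matrix.of_apply]
  exact (sum_comm₄' fun a b c d => Complex.normSq (L (a, b) (c, d))).symm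

/-- The amplitude of a transition between Bell states, as a matrix coefficient. -/
theorem normSq_bell_amplitude (n : ℕ) (g : SO3)
    (L : Matrix (Fin (1 + 1) × Fin (1 + 1)) (Fin (n + 1) × Fin (n + 1)) ℂ) :
    Complex.normSq (star (rotatedBell 1 g) ⬝ᵥ (L *ᵥ rotatedBell n g)) =
      1 / (2 * (n + 1)) * Complex.normSq
        (realign L * pairUnitary n g).trace := by
  have e : star (rotatedBell 1 g) ⬝ᵥ (L *ᵥ rotatedBell n g) =
      (((√((1 : ℕ) + 1 : ℝ))⁻¹ : ℝ) : ℂ) * (((√(n + 1 : ℝ))⁻¹ : ℝ) : ℂ) *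
      (realign L * pairUnitary n g).trace := by
    have e1 : star (rotatedBell 1 g) ⬝ᵥ (L *ᵥ rotatedBell n g) =
        ∑ a, ∑ b, ∑ c, ∑ d, (((√((1 : ℕ) + 1 : ℝ))⁻¹ : ℝ) : ℂ) * (((√(n + 1 : ℝ))⁻¹ : ℝ) : ℂ) *
          (L (a, b) (c, d) * (star (rotationUnitary 1 g a b) * rotationUnitary n g c d)) := by
      simp only [dotProduct, Matrix.mulVec, rotatedBell_apply, Pi.star_apply, star_mul,
        Fintype.sum_prod_type, Finset.mul_sum, Complex.star_def, Complex.conj_ofReal]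
      exact Finset.sum_congr rfl fun _ _ => Finset.sum_congr rfl fun _ _ =>
        Finset.sum_congr rfl fun _ _ => Finset.sum_congr rfl fun _ _ => by ring
    have e2 : (realign L * pairUnitary n g).trace =
        ∑ b, ∑ d, ∑ a, ∑ c,
          L (a, b) (c, d) * (star (rotationUnitary 1 g a b) * rotationUnitary n g c d) := by
      simp only [Matrix.trace, Matrix.diag_apply, Matrix.mul_apply, realign,
        Matrix.of_apply, Fintype.sum_prod_type, pairUnitary, conjKron_apply]
    rw [e1, e2, sum_comm₄']
    simp only [Finset.mul_sum]
  rw [e, Complex.normSq_mul, Complex.normSq_mul, normSq_inv_sqrt, normSq_inv_sqrt]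
  push_cast
  field_simp
  ring

theorem continuous_normSq_bell_amplitude (n : ℕ)
    (L : Matrix (Fin (1 + 1) × Fin (1 + 1)) (Fin (n + 1) × Fin (n + 1)) ℂ) :
    Continuous fun g =>
      Complex.normSq (star (rotatedBell 1 g) ⬝ᵥ (L *ᵥ rotatedBell n g)) := by
  simp only [normSq_bell_amplitude]
  exact continuous_const.mul ((isProjectiveRep_pairUnitary n).continuous_normSq_trace _)

theorem continuous_normSq_dotProduct (n : ℕ) (v : Fin (n + 1) × Fin (n + 1) → ℂ) :
    Continuous fun g => Complex.normSq (v ⬝ᵥ rotatedBell n g) := by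
  simp only [normSq_dotProduct_rotatedBell]
  exact continuous_const.mul ((isProjectiveRep_rotationUnitary n).continuous_normSq_trace _)

/-- One factor `n + 1` normalizes the Bell state, the other is the dimension in Schur orthogonality.
-/
theorem integral_normSq_dotProduct (n : ℕ) (v : Fin (n + 1) × Fin (n + 1) → ℂ) :
    ∫ g, Complex.normSq (v ⬝ᵥ rotatedBell n g) ∂haarSO3 =
      (∑ p, Complex.normSq (v p)) / (n + 1) ^ 2 := by
  simp only [normSq_dotProduct_rotatedBell]
  rw [integral_const_mul, integral_normSq_rotationUnitary, Fintype.sum_prod_type, Finset.sum_comm]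
  simp only [Matrix.of_apply]
  field_simp

/-- The factor `2(n + 1)` normalizes the two Bell states; the factor `n` is the smaller dimension in
the product representation. -/
theorem integral_normSq_bell_amplitude_le {n : ℕ} (hn : n ≠ 0)
    (L : Matrix (Fin (1 + 1) × Fin (1 + 1)) (Fin (n + 1) × Fin (n + 1)) ℂ) :
    ∫ g, Complex.normSq (star (rotatedBell 1 g) ⬝ᵥ (L *ᵥ rotatedBell n g)) ∂haarSO3 ≤
      (∑ x, ∑ p, Complex.normSq (L x p)) / (2 * n * (n + 1)) := by
  simp only [normSq_bell_amplitude]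
  rw [integral_const_mul]
  have h := integral_normSq_pairUnitary_le hn (realign L)
  rw [sum_normSq_realign] at h
  have h0 : (0 : ℝ) ≤ 1 / (2 * (n + 1)) := by positivity
  refine (mul_le_mul_of_nonneg_left h h0).trans (le_of_eq ?_)
  have : (n : ℝ) ≠ 0 := Nat.cast_ne_zero.2 hn
  field_simp

/-! ### Reduction to one refbit -/

theorem sum_normSq_tensorPower {ι : Type} [Fintype ι] (m : ℕ) (ψ : ι → ℂ) :
    ∑ f, Complex.normSq (tensorPower m ψ f) = (∑ x, Complex.normSq (ψ x)) ^ m := by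
  simp only [tensorPower, map_prod]
  exact (Fintype.sum_pow (fun x => Complex.normSq (ψ x)) m).symm

theorem normSq_sum_mul_le {ι : Type*} [Fintype ι] (x y : ι → ℂ) :
    Complex.normSq (∑ i, star (x i) * y i) ≤
      (∑ i, Complex.normSq (x i)) * ∑ i, Complex.normSq (y i) := by
  simp only [Complex.normSq_eq_norm_sq]
  have h : ‖∑ i, star (x i) * y i‖ ≤ ∑ i, ‖x i‖ * ‖y i‖ :=
    (norm_sum_le _ _).trans (le_of_eq (by simp))
  exact (pow_le_pow_left₀ (norm_nonneg _) h 2).trans (Finset.sum_mul_sq_le_sq_mul_sq _ _ _)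

/-- The overlap with several copies of a unit vector is at most the overlap with one copy. -/
theorem normSq_dotProduct_tensorPower_le {ι : Type} [Fintype ι] (m : ℕ) {ψ : ι → ℂ}
    (hψ : ∑ x, Complex.normSq (ψ x) = 1) (v : (Fin (m + 1) → ι) → ℂ) :
    Complex.normSq (star (tensorPower (m + 1) ψ) ⬝ᵥ v) ≤
      ∑ f : Fin m → ι, Complex.normSq (star ψ ⬝ᵥ fun x => v (Fin.cons x f)) := by
  -- Contract the first copy only; the remaining copies form a unit vector, against which
  -- Cauchy-Schwarz applies.
  have e : star (tensorPower (m + 1) ψ) ⬝ᵥ v =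
      ∑ f : Fin m → ι, star (tensorPower m ψ f) * (star ψ ⬝ᵥ fun x => v (Fin.cons x f)) := by
    rw [dotProduct, ← (Fin.consEquiv fun _ => ι).sum_comp, Fintype.sum_prod_type,
      Finset.sum_comm]
    refine Finset.sum_congr rfl fun f _ => ?_
    rw [dotProduct, Finset.mul_sum]
    refine Finset.sum_congr rfl fun x _ => ?_
    simp only [tensorPower, Pi.star_apply, Fin.prod_univ_succ, star_mul]
    rw [mul_assoc]
    rfl
  rw [e]
  refine (normSq_sum_mul_le _ _).trans (le_of_eq ?_)
  rw [sum_normSq_tensorPower, hψ, one_pow, one_mul]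

/-! ### Overlaps and success probabilities through Kraus operators. -/

section Machine

variable {ι κ : Type} [Fintype ι] [Fintype κ]

theorem expVal_eq_sum {σ : Type} [Fintype σ] {A : CStarMatrix κ κ ℂ} {w : σ → κ → ℂ}
    (hA : CStarMatrix.ofMatrix.symm A = ∑ s, Matrix.vecMulVec (w s) (star (w s))) (ψ : κ → ℂ) :
    expVal A ψ = ∑ s, Complex.normSq (star ψ ⬝ᵥ w s) := by
  have e : star ψ ⬝ᵥ (CStarMatrix.ofMatrix.symm A *ᵥ ψ) =
      ((∑ s, Complex.normSq (star ψ ⬝ᵥ w s) : ℝ) : ℂ) := by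
    rw [hA, Matrix.sum_mulVec, dotProduct_sum]
    push_cast
    refine Finset.sum_congr rfl fun s _ => ?_
    rw [ofReal_normSq, Matrix.vecMulVec_mulVec, Matrix.star_dotProduct (w s), dotProduct_smul]
    rfl
  rw [expVal, e, Complex.ofReal_re]

theorem tr_re_eq_sum {σ : Type} [Fintype σ] {A : CStarMatrix κ κ ℂ} {w : σ → κ → ℂ}
    (hA : CStarMatrix.ofMatrix.symm A = ∑ s, Matrix.vecMulVec (w s) (star (w s))) :
    (tr A).re = ∑ s, ∑ x, Complex.normSq (w s x) := by
  have e : tr A = ((∑ s, ∑ x, Complex.normSq (w s x) : ℝ) : ℂ) := by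
    rw [tr, hA, Matrix.trace_sum]
    push_cast
    refine Finset.sum_congr rfl fun s _ => ?_
    simp only [ofReal_normSq]
    rfl
  rw [e, Complex.ofReal_re]

end Machine

theorem continuous_rotatedBell_mul_star (n : ℕ) (p q : Fin (n + 1) × Fin (n + 1)) :
    Continuous fun g => rotatedBell n g p * star (rotatedBell n g q) := by
  have h := (isProjectiveRep_rotationUnitary n).continuous_entry p.1 p.2 q.1 q.2
  refine (h.const_mul ((((√(n + 1 : ℝ))⁻¹ : ℝ) : ℂ) * (((√(n + 1 : ℝ))⁻¹ : ℝ) : ℂ))).congr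
    fun g => ?_
  rw [rotatedBell_apply, rotatedBell_apply, star_mul]
  simp only [Complex.star_def, Complex.conj_ofReal]
  ring

theorem continuous_refbits_mul_star (M : ℕ) (f f' : Fin M → Fin 2 × Fin 2) :
    Continuous fun g => refbits M g f * star (refbits M g f') := by
  have h : Continuous fun g => ∏ k, rotatedBell 1 g (f k) * star (rotatedBell 1 g (f' k)) :=
    continuous_finsetProd _ fun k _ => continuous_rotatedBell_mul_star 1 (f k) (f' k)
  refine h.congr fun g => ?_
  rw [Finset.prod_mul_distrib, refbits, tensorPower, tensorPower, star_prod]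

section Kraus

variable {n : ℕ}

theorem continuous_normSq_refbits_amplitude (M : ℕ)
    (K : Matrix (Fin M → Fin 2 × Fin 2) (Fin (n + 1) × Fin (n + 1)) ℂ) :
    Continuous fun g =>
      Complex.normSq (star (refbits M g) ⬝ᵥ (K *ᵥ rotatedBell n g)) := by
  have h : Continuous fun g => ((Complex.normSq
      (star (refbits M g) ⬝ᵥ (K *ᵥ rotatedBell n g)) : ℝ) : ℂ) := by
    -- In the expanded square every Bell amplitude is paired with a conjugate one, so each term is
    -- free of phases and continuous.
    have e : ∀ g, ((Complex.normSq (star (refbits M g) ⬝ᵥ (K *ᵥ rotatedBell n g)) : ℝ) : ℂ) =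
        ∑ f, ∑ p, ∑ f', ∑ q, K f p * star (K f' q) * (refbits M g f' * star (refbits M g f)) *
          (rotatedBell n g p * star (rotatedBell n g q)) := by
      intro g
      rw [ofReal_normSq]
      simp only [dotProduct, Matrix.mulVec, Pi.star_apply, Finset.mul_sum, star_sum, star_mul,
        star_star, Finset.sum_mul]
      conv_lhs => rw [sum_comm₄]
      exact Finset.sum_congr rfl fun _ _ => Finset.sum_congr rfl fun _ _ =>
        Finset.sum_congr rfl fun _ _ => Finset.sum_congr rfl fun _ _ => by ring
    simp only [e]
    exact continuous_finsetSum _ fun f _ => continuous_finsetSum _ fun p _ =>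
      continuous_finsetSum _ fun f' _ => continuous_finsetSum _ fun q _ =>
        (continuous_const.mul (continuous_refbits_mul_star M f' f)).mul
          (continuous_rotatedBell_mul_star n p q)
  exact Complex.continuous_re.comp h

/-- Fixing the output on all refbits but the first slices `K` into operators `L f`, to which the
one-refbit bound applies. Their squared norms add up to that of `K`, so extra refbits cost nothing.
-/
theorem integral_normSq_refbits_amplitude_le (hn : n ≠ 0) (m : ℕ)
    (K : Matrix (Fin (m + 1) → Fin 2 × Fin 2) (Fin (n + 1) × Fin (n + 1)) ℂ) :
    ∫ g, Complex.normSq (star (refbits (m + 1) g) ⬝ᵥ (K *ᵥ rotatedBell n g)) ∂haarSO3 ≤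
      (∑ f, ∑ p, Complex.normSq (K f p)) / (2 * n * (n + 1)) := by
  let L : (Fin m → Fin 2 × Fin 2) →
      Matrix (Fin (1 + 1) × Fin (1 + 1)) (Fin (n + 1) × Fin (n + 1)) ℂ :=
    fun f => Matrix.of fun x p => K (Fin.cons x f) p
  have h1 : ∀ g, Complex.normSq (star (refbits (m + 1) g) ⬝ᵥ (K *ᵥ rotatedBell n g)) ≤
      ∑ f, Complex.normSq (star (rotatedBell 1 g) ⬝ᵥ (L f *ᵥ rotatedBell n g)) := fun g =>
    normSq_dotProduct_tensorPower_le m (sum_normSq_rotatedBell 1 g) _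
  have hi : ∀ f, Integrable
      (fun g => Complex.normSq (star (rotatedBell 1 g) ⬝ᵥ (L f *ᵥ rotatedBell n g))) haarSO3 :=
    fun f => integrable_of_continuous (continuous_normSq_bell_amplitude n (L f))
  calc ∫ g, Complex.normSq (star (refbits (m + 1) g) ⬝ᵥ (K *ᵥ rotatedBell n g)) ∂haarSO3
      ≤ ∫ g, ∑ f, Complex.normSq (star (rotatedBell 1 g) ⬝ᵥ (L f *ᵥ rotatedBell n g))
          ∂haarSO3 :=
        integral_mono (integrable_of_continuous (continuous_normSq_refbits_amplitude _ K))
          (integrable_finsetSum _ fun f _ => hi f) h1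
    _ = ∑ f, ∫ g, Complex.normSq (star (rotatedBell 1 g) ⬝ᵥ (L f *ᵥ rotatedBell n g))
          ∂haarSO3 := integral_finsetSum _ fun f _ => hi f
    _ ≤ ∑ f, (∑ x, ∑ p, Complex.normSq (L f x p)) / (2 * n * (n + 1)) :=
        Finset.sum_le_sum fun f _ => integral_normSq_bell_amplitude_le hn (L f)
    _ = (∑ f, ∑ p, Complex.normSq (K f p)) / (2 * n * (n + 1)) := by
        rw [← Finset.sum_div]
        congr 1
        rw [← (Fin.consEquiv fun _ => Fin 2 × Fin 2).sum_comp, Fintype.sum_prod_type,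
          Finset.sum_comm]
        rfl

theorem continuous_normSq_mulVec {κ : Type} (K : Matrix κ (Fin (n + 1) × Fin (n + 1)) ℂ) (x : κ) :
    Continuous fun g => Complex.normSq ((K *ᵥ rotatedBell n g) x) :=
  continuous_normSq_dotProduct n (K x)

theorem integral_normSq_mulVec {κ : Type} [Fintype κ]
    (K : Matrix κ (Fin (n + 1) × Fin (n + 1)) ℂ) :
    ∫ g, ∑ x, Complex.normSq ((K *ᵥ rotatedBell n g) x) ∂haarSO3 =
      (∑ x, ∑ p, Complex.normSq (K x p)) / (n + 1) ^ 2 := by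
  rw [integral_finsetSum _ fun x _ => integrable_of_continuous (continuous_normSq_mulVec K x),
    Finset.sum_div]
  exact Finset.sum_congr rfl fun x _ => integral_normSq_dotProduct n (K x)

end Kraus

/-! ### The bound for completely positive maps. -/

theorem continuous_overlap (n M : ℕ) (C : AnalyserMap n M) : Continuous (overlap n M C) := by
  obtain ⟨K, hK⟩ := exists_kraus C
  have e : overlap n M C = fun g =>
      ∑ s, Complex.normSq (star (refbits M g) ⬝ᵥ (K s *ᵥ rotatedBell n g)) :=
    funext fun g => expVal_eq_sum (hK _) _
  rw [e]
  exact continuous_finsetSum _ fun s _ => continuous_normSq_refbits_amplitude M (K s)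

theorem continuous_successProbAt (n M : ℕ) (C : AnalyserMap n M) :
    Continuous (successProbAt n M C) := by
  obtain ⟨K, hK⟩ := exists_kraus C
  have e : successProbAt n M C = fun g =>
      ∑ s, ∑ x, Complex.normSq ((K s *ᵥ rotatedBell n g) x) :=
    funext fun g => tr_re_eq_sum (hK _)
  rw [e]
  exact continuous_finsetSum _ fun s _ => continuous_finsetSum _ fun x _ =>
    continuous_normSq_mulVec (K s) x

/-- The average overlap of any completely positive map with one or more refbits is bounded by its
success probability. -/
theorem integral_overlap_le {n M : ℕ} (hn : 1 ≤ n) (hM : 1 ≤ M) (C : AnalyserMap n M) :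
    ∫ g, overlap n M C g ∂haarSO3 ≤ 1 / 2 * (1 + 1 / (2 * spin n)) * successProb n M C := by
  obtain ⟨m, rfl⟩ := Nat.exists_eq_add_of_le' hM
  obtain ⟨K, hK⟩ := exists_kraus C
  have hn0 : n ≠ 0 := by omega
  have e1 : ∫ g, overlap n (m + 1) C g ∂haarSO3 = ∑ s, ∫ g, Complex.normSq
      (star (refbits (m + 1) g) ⬝ᵥ (K s *ᵥ rotatedBell n g)) ∂haarSO3 := by
    rw [← integral_finsetSum _ fun s _ =>
      integrable_of_continuous (continuous_normSq_refbits_amplitude _ (K s))]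
    exact integral_congr_ae (Filter.Eventually.of_forall fun g => expVal_eq_sum (hK _) _)
  have e2 : successProb n (m + 1) C = ∑ s, ∫ g, ∑ x, Complex.normSq
      ((K s *ᵥ rotatedBell n g) x) ∂haarSO3 := by
    rw [← integral_finsetSum _ fun s _ => integrable_of_continuous
      (continuous_finsetSum _ fun x _ => continuous_normSq_mulVec (K s) x)]
    exact integral_congr_ae (Filter.Eventually.of_forall fun g => tr_re_eq_sum (hK _))
  rw [e1, e2, Finset.mul_sum]
  -- The inequality holds for each Kraus operator separately: the constant is `(n + 1)² / (2n(n +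
  -- 1))`, with `n = 2J`.
  refine Finset.sum_le_sum fun s _ => ?_
  rw [integral_normSq_mulVec]
  refine (integral_normSq_refbits_amplitude_le hn0 m (K s)).trans (le_of_eq ?_)
  have : (n : ℝ) ≠ 0 := Nat.cast_ne_zero.2 hn0
  simp only [spin]
  field_simp

theorem successProb_eq_one {n M : ℕ} {C : AnalyserMap n M} (hC : IsChannel C) :
    successProb n M C = 1 := by
  have h : ∀ g, successProbAt n M C g = 1 := by
    intro g
    have e : tr (proj (rotatedBell n g)) =
        ((∑ p, Complex.normSq (rotatedBell n g p) : ℝ) : ℂ) := by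
      push_cast
      simp only [ofReal_normSq]
      rfl
    rw [successProbAt, hC, e, sum_normSq_rotatedBell, Complex.ofReal_re]
  simp [successProb, h]

/-- Spins are half-integers, so `J > 1/2` means `J ≥ 1`, where the bound is already `3/4`. -/
theorem bound_le_three_quarters {n : ℕ} (h : 1 / 2 < spin n) :
    1 / 2 * (1 + 1 / (2 * spin n)) ≤ 3 / 4 := by
  have h1 : (1 : ℝ) < n := by simp only [spin] at h; linarith
  have h2 : (2 : ℝ) ≤ n := by exact_mod_cast (show 1 < n by exact_mod_cast h1)
  have h3 : 2 * spin n = n := by simp only [spin]; ring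
  have h4 : 1 / (n : ℝ) ≤ 1 / 2 := one_div_le_one_div_of_le (by norm_num) h2
  rw [h3]
  linarith

end SpinBell

end

/-- Integrability is part of the conclusion because the integral of a non-integrable function is `0`
by convention, which would make an upper bound meaningless. -/
theorem proposition1 (n M : ℕ) (hn : 1 ≤ n) (hM : 1 ≤ M) :
    (∀ C : SpinBell.AnalyserMap n M, SpinBell.IsChannel C →
      Integrable (SpinBell.overlap n M C) SpinBell.haarSO3 ∧
      SpinBell.detFidelity n M C ≤ 1 / 2 * (1 + 1 / (2 * SpinBell.spin n)) ∧
      (1 / 2 < SpinBell.spin n → SpinBell.detFidelity n M C ≤ 3 / 4)) ∧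
    (∀ C : SpinBell.AnalyserMap n M, SpinBell.IsOperation C → 0 < SpinBell.successProb n M C →
      Integrable (SpinBell.overlap n M C) SpinBell.haarSO3 ∧
      Integrable (SpinBell.successProbAt n M C) SpinBell.haarSO3 ∧
      SpinBell.probFidelity n M C ≤ 1 / 2 * (1 + 1 / (2 * SpinBell.spin n)) ∧
      (1 / 2 < SpinBell.spin n → SpinBell.probFidelity n M C ≤ 3 / 4)) := by
  refine ⟨fun C hC => ?_, fun C _ hp => ?_⟩
  · have h : SpinBell.detFidelity n M C ≤ 1 / 2 * (1 + 1 / (2 * SpinBell.spin n)) := by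
      have := SpinBell.integral_overlap_le hn hM C
      rwa [SpinBell.successProb_eq_one hC, mul_one] at this
    exact ⟨SpinBell.integrable_of_continuous (SpinBell.continuous_overlap n M C), h,
      fun hs => h.trans (SpinBell.bound_le_three_quarters hs)⟩
  · have h : SpinBell.probFidelity n M C ≤ 1 / 2 * (1 + 1 / (2 * SpinBell.spin n)) :=
      (div_le_iff₀ hp).2 (SpinBell.integral_overlap_le hn hM C)
    exact ⟨SpinBell.integrable_of_continuous (SpinBell.continuous_overlap n M C),
      SpinBell.integrable_of_continuous (SpinBell.continuous_successProbAt n M C), h,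
      fun hs => h.trans (SpinBell.bound_le_three_quarters hs)⟩
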